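/- **Setting.** For $n,k\in\mathbb{N}=\{1,2,\dots\}$ the *Razak block* $A_{n,k}$ is the C*-algebra $$A_{n,k}=\{f\in C([0,1],M_{nk}(\mathbb{C}))\mid \exists a\in M_k(\mathbb{C}):\ f(0)=\mathrm{diag}(\underbrace{a,\dots,a}_{n}),\ f(1)=\mathrm{diag}(\underbrace{a,\dots,a}_{n-1},0_k)\}.$$ *Diagonal maps.* Let $A=A_{n,k}\subseteq C([0,1],M_N)$ and $B=A_{n',k'}\subseteq C([0,1],M_{N'})$, where $N=nk$ and $N'=n'k'$. A *-homomorphism $\varphi\colon A\to B$ is *diagonal* if $N'=lN$ for some $l\in\mathbb{N}$ and there are continuous maps $\xi_1\le\dots\le\xi_l\colon[0,1]\to[0,1]$ (said to be *associated* to $\varphi$) and unitaries $u(t)\in M_{N'}$, $t\in[0,1]$ (not necessarily continuous in $t$), such that $$\varphi(f)(t)=u(t)\,\mathrm{diag}(f(\xi_1(t)),\dots,f(\xi_l(t)))\,u(t)^*\qquad(f\in A,\ t\in[0,1]).$$ *Lipschitz families.* For $S\subseteq C([0,1],M_N)$ let $\mathrm{Lip}(S)$ be the set of self-adjoint $f\in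 S$ with $\|f\|\le1$ and $\|f(x)-f(y)\|\le|x-y|$ for all $x,y\in[0,1]$. A *Lipschitz family* in $A$ is a set $\mathcal{L}=u\,\mathrm{Lip}(u^*Au)\,u^*\subseteq A$, where $u\in C([0,1],M_N)$ is a continuous path of unitaries such that $u(0)$ and $u(1)$ are permutation matrices. *Distances.* Let $\tilde B$ be the minimal unitization of $B$ and $\mathcal{U}(\tilde B)$ its unitary group. For $a,b\ge0$ in $\tilde B$ write $a\precsim b$ if for every $\varepsilon>0$ there is $x\in\tilde B$ with $\|x^*bx-a\|<\varepsilon$. For an open set $O\subseteq\mathbb{C}$ let $f_O\colon\mathbb{C}\to[0,\infty)$ denote any continuous function with $\{z\mid f_O(z)\ne0\}=O$, and let $O_r$ be the open $r$-neighbourhood of $O$. For normal $a,b\in B$, applying $f_O$ by continuous functional calculus in $\tilde B$, set $$d_W(a,b)=\sup_{U\subseteq\mathbb{C}\text{ open}}\inf\{r>0\mid f_U(a)\precsim f_{U_r}(b),\ f_U(b)\precsim f_{U_r}(a)\}.$$ Given a Lipschitz family $\mathcal{L}\subseteq A$ and *-homomorphisms $\varphi,\psi\colon A\to B$, set $$d_W(\varphi,\psi)=\sup_{f\in\mathcal{L}}d_W(\varphi(f),\psi(f)),\qquad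 d_{\mathcal{U}}(\varphi,\psi)=\sup_{F\subseteq\mathcal{L}\text{ finite}}\ \inf_{u\in\mathcal{U}(\tilde B)}\ \sup_{f\in F}\|u\varphi(f)u^*-\psi(f)\|,$$ and, if $\varphi,\psi$ are diagonal with associated maps $\xi_i^\varphi$ and $\xi_i^\psi$ $(1\le i\le l)$, $$d_\partial(\varphi,\psi)=\sup_{t\in[0,1]}\max_{1\le i\le l}|\xi_i^\varphi(t)-\xi_i^\psi(t)|.$$ **Proposition.** Let $A$ and $B$ be Razak blocks, let $\varphi,\psi\colon A\to B$ be diagonal *-monomorphisms (with any choice of associated maps), and let $\mathcal{L}\subseteq A$ be any Lipschitz family. Then, relative to $\mathcal{L}$, $$d_{\mathcal{U}}(\varphi,\psi)=d_\partial(\varphi,\psi)=d_W(\varphi,\psi).$$ -/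

import Mathlib

open scoped unitInterval ENNReal Matrix.Norms.L2Operator

noncomputable section

/-! ### Distances between elements of, and maps into, a C⋆-algebra

For a C⋆-algebra `B`, the unitization is `Unitization ℂ B`, with its C⋆-norm. It is the minimal
unitization whenever `B` is non-unital (as is every Razak block `A_{n,k}` with `n, k ≥ 1`). -/

/-- Cuntz subequivalence: `a` is a norm limit of elements of the form `x⋆ b x`. -/
def CuntzLE {A : Type*} [NonUnitalCStarAlgebra A] (a b : A) : Prop :=
  ∀ ε : ℝ, 0 < ε → ∃ x : A, ‖star x * b * x - a‖ < ε

/-- `f_U(a) ≾ f_V(b)` in the unitization of `B`, where `f_O : ℂ → [0, ∞)` stands for any continuous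
function whose open support `{z | f_O z ≠ 0}` is `O`, and is applied to a normal element by the
continuous functional calculus. Every open set `O` has such an `f_O`, and up to Cuntz equivalence
the choice does not matter. -/
def OpenCuntzLE {B : Type*} [NonUnitalCStarAlgebra B] (U V : Set ℂ) (a b : B) : Prop :=
  ∀ f g : C(ℂ, ℝ), 0 ≤ f → 0 ≤ g → Function.support f = U → Function.support g = V →
    CuntzLE (cfc (fun z : ℂ => (f z : ℂ)) (a : Unitization ℂ B))
      (cfc (fun z : ℂ => (g z : ℂ)) (b : Unitization ℂ B))

/-- The Cuntz distance `d_W(a, b)` between normal elements `a` and `b` of a C⋆-algebra: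
the supremum over open `U` of the infimum of those `r > 0` for which
`f_U(a) ≾ f_{U_r}(b)` and `f_U(b) ≾ f_{U_r}(a)`, with `U_r` the open `r`-neighbourhood of `U`. -/
def cuntzDistElem {B : Type*} [NonUnitalCStarAlgebra B] (a b : B) : ℝ≥0∞ :=
  ⨆ (U : Set ℂ) (_ : IsOpen U), ⨅ (r : ℝ) (_ : 0 < r)
    (_ : OpenCuntzLE U (Metric.thickening r U) a b ∧ OpenCuntzLE U (Metric.thickening r U) b a),
    ENNReal.ofReal r

/-- The Cuntz distance `d_W(φ, ψ)` relative to a set `L` of elements of the domain. -/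
def cuntzDist {A B : Type*} [NonUnitalCStarAlgebra A] [NonUnitalCStarAlgebra B]
    (L : Set A) (φ ψ : A →⋆ₙₐ[ℂ] B) : ℝ≥0∞ :=
  ⨆ f ∈ L, cuntzDistElem (φ f) (ψ f)

/-- The unitary distance `d_U(φ, ψ)` relative to a set `L` of elements of the domain:
the supremum over finite `F ⊆ L` of the infimum over unitaries `u` in the unitization of `B` of
`sup_{f ∈ F} ‖u φ(f) u⋆ - ψ(f)‖`. -/
def unitaryDist {A B : Type*} [NonUnitalCStarAlgebra A] [NonUnitalCStarAlgebra B]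
    (L : Set A) (φ ψ : A →⋆ₙₐ[ℂ] B) : ℝ≥0∞ :=
  ⨆ (F : Finset A) (_ : (F : Set A) ⊆ L), ⨅ u : unitary (Unitization ℂ B), ⨆ f ∈ F,
    ‖(u : Unitization ℂ B) * (φ f : Unitization ℂ B) * star (u : Unitization ℂ B)
      - (ψ f : Unitization ℂ B)‖ₑ

/-! ### Lipschitz families and diagonal homomorphisms -/

/-- The C⋆-algebra `C([0,1], M_ι)`; matrices carry the operator norm. -/
abbrev MatPath (ι : Type*) [Fintype ι] [DecidableEq ι] := C(I, Matrix ι ι ℂ)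

section

variable {ι κ : Type*} [Fintype ι] [DecidableEq ι] [Fintype κ] [DecidableEq κ]

/-- The contractive self-adjoint elements of `S ⊆ C([0,1], M_ι)` that are `1`-Lipschitz. -/
def lipUnit (S : Set (MatPath ι)) : Set (MatPath ι) :=
  {f | f ∈ S ∧ IsSelfAdjoint f ∧ ‖f‖ ≤ 1 ∧ ∀ x y : I, ‖f x - f y‖ ≤ |(x : ℝ) - (y : ℝ)|}

/-- A Lipschitz family in `A ⊆ C([0,1], M_ι)` is a set of the form `u lip(u⋆ A u) u⋆`, for a
continuous path `u` of unitary matrices whose values at `0` and `1` are permutation matrices. -/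
def IsLipschitzFamily {A : NonUnitalStarSubalgebra ℂ (MatPath ι)} (L : Set A) : Prop :=
  ∃ u : MatPath ι, (∀ t, u t ∈ Matrix.unitaryGroup ι ℂ) ∧
    (∃ p : Equiv.Perm ι, u 0 = p.permMatrix ℂ) ∧ (∃ q : Equiv.Perm ι, u 1 = q.permMatrix ℂ) ∧
    ((↑) : A → MatPath ι) '' L =
      (fun g => u * g * star u) '' lipUnit ((fun f => star u * f * u) '' (A : Set (MatPath ι)))

/-- `φ : A → B` is diagonal with associated maps `ξ_1 ≤ ⋯ ≤ ξ_l`, that is,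
`φ(f)(t) = u(t) diag(f(ξ_1(t)), …, f(ξ_l(t))) u(t)⋆` for unitaries `u(t)`, not required to be
continuous in `t`. The bijection `e` (which exists exactly when the matrix sizes satisfy
`|κ| = l |ι|`) only labels the standard basis; changing it multiplies `u` by a permutation
matrix. -/
def IsDiagonalWith {A : NonUnitalStarSubalgebra ℂ (MatPath ι)}
    {B : NonUnitalStarSubalgebra ℂ (MatPath κ)} (φ : A →⋆ₙₐ[ℂ] B) {l : ℕ}
    (ξ : Fin l → C(I, I)) : Prop :=
  (∀ t, Monotone fun i => ξ i t) ∧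
    ∃ (e : ι × Fin l ≃ κ) (u : I → Matrix κ κ ℂ), (∀ t, u t ∈ Matrix.unitaryGroup κ ℂ) ∧
      ∀ (f : A) (t : I), (φ f : MatPath κ) t =
        u t * Matrix.reindex e e
          (Matrix.blockDiagonal fun i => (f : MatPath ι) (ξ i t)) * star (u t)

end

/-- The diagonal distance between diagonal homomorphisms with associated maps `ξ` and `η`:
`sup_t max_i |ξ_i(t) - η_i(t)|`. -/
def diagonalDist {l : ℕ} (ξ η : Fin l → C(I, I)) : ℝ≥0∞ :=
  ⨆ (t : I) (i : Fin l), edist (ξ i t) (η i t)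

/-! ### Razak blocks -/

/-- `diag(a, …, a, 0)` with `n - 1` copies of `a ∈ M_k` and one zero block of size `k`. -/
def lastZeroDiag (n k : ℕ) (a : Matrix (Fin k) (Fin k) ℂ) :
    Matrix (Fin k × Fin n) (Fin k × Fin n) ℂ :=
  Matrix.blockDiagonal fun j : Fin n => if (j : ℕ) + 1 < n then a else 0

theorem lastZeroDiag_add (n k : ℕ) (a b : Matrix (Fin k) (Fin k) ℂ) :
    lastZeroDiag n k (a + b) = lastZeroDiag n k a + lastZeroDiag n k b := by
  rw [lastZeroDiag, lastZeroDiag, lastZeroDiag, ← Matrix.blockDiagonal_add]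
  congr 1; funext j; by_cases h : (j : ℕ) + 1 < n <;> simp [h]

theorem lastZeroDiag_mul (n k : ℕ) (a b : Matrix (Fin k) (Fin k) ℂ) :
    lastZeroDiag n k (a * b) = lastZeroDiag n k a * lastZeroDiag n k b := by
  rw [lastZeroDiag, lastZeroDiag, lastZeroDiag, ← Matrix.blockDiagonal_mul]
  congr 1; funext j; by_cases h : (j : ℕ) + 1 < n <;> simp [h]

theorem lastZeroDiag_smul (n k : ℕ) (c : ℂ) (a : Matrix (Fin k) (Fin k) ℂ) :
    lastZeroDiag n k (c • a) = c • lastZeroDiag n k a := by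
  rw [lastZeroDiag, lastZeroDiag, ← Matrix.blockDiagonal_smul]
  congr 1; funext j; by_cases h : (j : ℕ) + 1 < n <;> simp [h]

theorem lastZeroDiag_zero (n k : ℕ) : lastZeroDiag n k 0 = 0 := by
  simpa using lastZeroDiag_smul n k 0 0

theorem lastZeroDiag_star (n k : ℕ) (a : Matrix (Fin k) (Fin k) ℂ) :
    lastZeroDiag n k (star a) = star (lastZeroDiag n k a) := by
  rw [lastZeroDiag, lastZeroDiag, Matrix.star_eq_conjTranspose, Matrix.star_eq_conjTranspose,
    Matrix.blockDiagonal_conjTranspose]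
  congr 1; funext j; by_cases h : (j : ℕ) + 1 < n <;> simp [h]

/-- The Razak block `A_{n,k}`: the paths `f` in `M_{nk}` such that, for some `a ∈ M_k`,
`f(0) = diag(a, …, a)` (`n` copies) and `f(1) = diag(a, …, a, 0)` (`n - 1` copies). The index
`(i, j) : Fin k × Fin n` is the `i`-th basis vector of the `j`-th block. -/
def razakBlock (n k : ℕ) : NonUnitalStarSubalgebra ℂ (MatPath (Fin k × Fin n)) where
  carrier := {f | ∃ a : Matrix (Fin k) (Fin k) ℂ,
    f 0 = Matrix.blockDiagonal (fun _ : Fin n => a) ∧ f 1 = lastZeroDiag n k a}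
  add_mem' := by
    rintro f g ⟨a, h0, h1⟩ ⟨b, h0', h1'⟩
    refine ⟨a + b, ?_, ?_⟩
    · rw [ContinuousMap.add_apply, h0, h0', ← Matrix.blockDiagonal_add]; rfl
    · rw [ContinuousMap.add_apply, h1, h1', lastZeroDiag_add]
  zero_mem' := ⟨0, (Matrix.blockDiagonal_zero).symm, (lastZeroDiag_zero n k).symm⟩
  mul_mem' := by
    rintro f g ⟨a, h0, h1⟩ ⟨b, h0', h1'⟩
    refine ⟨a * b, ?_, ?_⟩
    · rw [ContinuousMap.mul_apply, h0, h0', ← Matrix.blockDiagonal_mul]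
    · rw [ContinuousMap.mul_apply, h1, h1', lastZeroDiag_mul]
  smul_mem' := by
    rintro c f ⟨a, h0, h1⟩
    refine ⟨c • a, ?_, ?_⟩
    · rw [ContinuousMap.smul_apply, h0, ← Matrix.blockDiagonal_smul]; rfl
    · rw [ContinuousMap.smul_apply, h1, lastZeroDiag_smul]
  star_mem' := by
    rintro f ⟨a, h0, h1⟩
    refine ⟨star a, ?_, ?_⟩
    · rw [ContinuousMap.star_apply, h0, Matrix.star_eq_conjTranspose,
        Matrix.blockDiagonal_conjTranspose]; rfl
    · rw [ContinuousMap.star_apply, h1, lastZeroDiag_star]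

/-- Razak blocks are norm closed, hence are C⋆-algebras. -/
instance razakBlock_isClosed (n k : ℕ) :
    IsClosed (razakBlock n k : Set (MatPath (Fin k × Fin n))) := by
  let T : Matrix (Fin k) (Fin k) ℂ →ₗ[ℂ]
      Matrix (Fin k × Fin n) (Fin k × Fin n) ℂ × Matrix (Fin k × Fin n) (Fin k × Fin n) ℂ :=
    { toFun := fun a => (Matrix.blockDiagonal (fun _ : Fin n => a), lastZeroDiag n k a)
      map_add' := fun a b => by
        rw [Prod.mk_add_mk, ← Matrix.blockDiagonal_add, lastZeroDiag_add]; rfl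
      map_smul' := fun c a => by
        rw [RingHom.id_apply, Prod.smul_mk, ← Matrix.blockDiagonal_smul, lastZeroDiag_smul]; rfl }
  have hc : Continuous fun f : MatPath (Fin k × Fin n) => (f 0, f 1) :=
    (ContinuousEvalConst.continuous_eval_const 0).prodMk
      (ContinuousEvalConst.continuous_eval_const 1)
  have hT : IsClosed (LinearMap.range T : Set (Matrix (Fin k × Fin n) (Fin k × Fin n) ℂ ×
      Matrix (Fin k × Fin n) (Fin k × Fin n) ℂ)) := (LinearMap.range T).closed_of_finiteDimensional
  convert hT.preimage hc using 1
  ext f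
  constructor
  · rintro ⟨a, h0, h1⟩
    exact ⟨a, Prod.ext h0.symm h1.symm⟩
  · rintro ⟨a, h⟩
    exact ⟨a, (congrArg Prod.fst h).symm, (congrArg Prod.snd h).symm⟩

end

/-!
The three distances are compared in a circle,
`d_U ≤ d_∂` (`unitaryDist_le_diagonalDist`), `d_∂ ≤ d_W` (`diagonalDist_le_cuntzDist`) and
`d_W ≤ d_U` (`cuntzDist_le_unitaryDist`).

`d_W ≤ d_U` holds for every set of self-adjoint elements in a C⋆-algebra. After conjugating by a unitary it says that self-adjoint `a`,
`b` with `‖a - b‖ < r` satisfy `f_U(a) ≾ f_{U_r}(b)` (`cuntzLE_cfc_of_norm_sub_lt`). The part of the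
spectrum of `a` where `f_U ≥ ε` splits into finitely many clusters, contained in intervals whose
`r`-neighbourhoods are pairwise disjoint subsets of `U_r`. On one cluster, a vector in the spectral
subspace of `a` for the interval of radius `ρ` around `c` is moved by `b - c` by less than `ρ + r`
times its length, so the part of `b` in the concentric interval of radius `ρ + r` dominates.

For `d_∂ ≤ d_W`, every Lipschitz family contains a function `f` which is pointwise unitarily
equivalent to `diag(1, …, 1, 1 - t)`. The eigenvalues of `φ(f)(t)` are then `1` and the
`1 - ξ_i(t)`, and a Cuntz subequivalence cannot increase the rank at a point `t`; counting the
eigenvalues in half planes recovers `|ξ_i(t) - η_i(t)|`.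

For `d_U ≤ d_∂`, let `φ(f)(t) = u(t) D_ξ(f)(t) u(t)⋆` and `ψ(f)(t) = u'(t) D_η(f)(t) u'(t)⋆` with
`D_ξ(f)` block diagonal with blocks `f ∘ ξ_i`. On a finite set `u` and `u'` may be replaced by
continuous paths `v` and `v'` with the same endpoints, up to a small error, because the unitaries
commuting with a `⋆`-closed set of matrices form a path connected set
(`exists_continuous_conjError_lt`). If the Lipschitz family is given by the path `w` of unitaries,
the block diagonal `W` with blocks `w(η_i) w(ξ_i)⋆` conjugates `D_ξ(f)` to within `d_∂` of `D_η(f)`,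
and `z = v' W v⋆` conjugates `φ(f)` approximately to `ψ(f)`. It remains to choose the endpoints so
that `z - 1` lies in the target Razak block. Two facts make this possible:

* traces show that at the endpoints the points `ξ_i` occur with multiplicities (essentially `n'` at
  `0` and `n' - 1` at `1`) which only depend on a common counting function
  (`IsDiagonalWith.exists_isCount`). Hence one relabelling of the basis at each endpoint
  turns *every* block diagonal matrix of this kind, for `ξ`, for `η` or for pairs `(ξ_i, η_i)`, into
  the form prescribed for the endpoints of an element of the target (`exists_endpoint_equiv`);
* if two representations of a `⋆`-closed family of matrices become equivalent after amplification,
  they are unitarily equivalent (`Matrix.exists_unitary_intertwiner`), so that the unitaries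
  at the endpoints can be chosen block diagonal with equal blocks.
-/

noncomputable section

/-! ### Cuntz comparison of nearby self-adjoint elements -/

section CuntzComparison

variable {A : Type*} [CStarAlgebra A]

/-- If `e² ≤ q` then `e² ≾ q`, with witness `x = (q + η)^{-1/2} e` for small `η`. -/
theorem cuntzLE_of_mul_self_le [PartialOrder A] [StarOrderedRing A] {e q : A}
    (he : IsSelfAdjoint e) (hq : 0 ≤ q) (hle : e * e ≤ q) : CuntzLE (e * e) q := by
  intro ε hε
  set η : ℝ := ε / 2 with hη
  have hη0 : 0 < η := by positivity
  have hqs : IsSelfAdjoint q := hq.isSelfAdjoint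
  have hspec : ∀ x ∈ spectrum ℝ q, 0 ≤ x := fun x hx => spectrum_nonneg_of_nonneg hq hx
  -- `y = (q + η)^{-1/2}`, so that `1 - y q y = η y²` and `‖y e‖ ≤ 1`
  have hc1 : ContinuousOn (fun x : ℝ => (Real.sqrt (x + η))⁻¹) (spectrum ℝ q) := by
    apply ContinuousOn.inv₀ (by fun_prop)
    intro x hx
    have := hspec x hx
    exact (Real.sqrt_pos.mpr (by linarith)).ne'
  set y : A := cfc (fun x : ℝ => (Real.sqrt (x + η))⁻¹) q with hy
  have hys : IsSelfAdjoint y := cfc_predicate _ _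
  have hyq : y * (q + algebraMap ℝ A η) * y = 1 := by
    have h1 : q + algebraMap ℝ A η = cfc (fun x : ℝ => x + η) q := by
      rw [cfc_add_const η (fun x => x) q, cfc_id' ℝ q]
    rw [h1, hy, ← cfc_mul _ _ q hc1, ← cfc_mul _ _ q _ hc1]
    · rw [← cfc_one ℝ q]
      apply cfc_congr
      intro x hx
      have h0 := hspec x hx
      have h2 : Real.sqrt (x + η) ≠ 0 := (Real.sqrt_pos.mpr (by linarith)).ne'
      have h3 : x + η = Real.sqrt (x + η) * Real.sqrt (x + η) :=
        (Real.mul_self_sqrt (by linarith)).symm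
      simp only [Pi.one_apply]
      field_simp
      rw [sq, ← h3]
    · exact hc1.mul (by fun_prop)
  have hcomm : Commute y q := (Commute.refl q).cfc_real _
  have hyy : y * q * y = 1 - η • (y * y) := by
    have : y * (q + algebraMap ℝ A η) * y = y * q * y + η • (y * y) := by
      rw [mul_add, add_mul, ← Algebra.commutes, mul_assoc (algebraMap ℝ A η), Algebra.smul_def]
    rw [← hyq, this]; abel
  have hnorm : ‖y * e‖ * ‖y * e‖ ≤ 1 := by
    have h1 : ‖y * e‖ * ‖y * e‖ = ‖y * (e * e) * y‖ := by
      rw [← CStarRing.norm_self_mul_star, star_mul, he.star_eq, hys.star_eq]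
      simp only [mul_assoc]
    rw [h1]
    have h2 : y * (e * e) * y ≤ 1 := by
      rw [← hyq]
      apply IsSelfAdjoint.conjugate_le_conjugate _ hys
      refine hle.trans ?_
      rw [le_add_iff_nonneg_right]
      exact algebraMap_nonneg A hη0.le
    have h3 : 0 ≤ y * (e * e) * y := by
      have := star_mul_self_nonneg (e * y)
      rwa [star_mul, he.star_eq, hys.star_eq, ← mul_assoc, mul_assoc y e e] at this
    refine (CStarAlgebra.norm_le_norm_of_nonneg_of_le h3 h2).trans ?_
    rcases subsingleton_or_nontrivial A with h | h
    · rw [Subsingleton.elim (1 : A) 0]; simp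
    · simp
  refine ⟨y * e, ?_⟩
  have h1 : star (y * e) * q * (y * e) - e * e = -(η • (star (y * e) * (y * e))) := by
    rw [star_mul, he.star_eq, hys.star_eq]
    calc e * y * q * (y * e) - e * e = e * (y * q * y) * e - e * e := by noncomm_ring
      _ = _ := by
        rw [hyy, mul_sub, sub_mul, mul_one, mul_smul_comm, smul_mul_assoc]
        simp only [mul_assoc]; abel
  rw [h1, norm_neg, norm_smul, CStarRing.norm_star_mul_self, Real.norm_of_nonneg hη0.le]
  nlinarith

theorem CuntzLE.of_smul_conj {e q z : A} {C : ℝ} (hC : 0 ≤ C)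
    (h : CuntzLE e (C • (star z * q * z))) : CuntzLE e q := by
  intro ε hε
  obtain ⟨x, hx⟩ := h ε hε
  refine ⟨Real.sqrt C • (z * x), ?_⟩
  convert hx using 3
  rw [star_smul, star_trivial, star_mul]
  simp only [smul_mul_assoc, mul_smul_comm, smul_smul, Real.mul_self_sqrt hC, mul_assoc]

theorem cfc_sub_algebraMap {a : A} (ha : IsSelfAdjoint a) (c : ℝ) :
    cfc (fun x : ℝ => x - c) a = a - algebraMap ℝ A c := by
  simp_rw [sub_eq_add_neg]
  rw [cfc_add_const (-c) (fun x => x) a, cfc_id' ℝ a, map_neg]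

/-- The weighted form of `‖X + Y‖² ≤ (‖X‖ + ‖Y‖)²` as an operator inequality; the weights are optimal
for `‖X‖ ≤ δ` and `‖Y‖ ≤ ρ`, where they give `(ρ + δ)²`. -/
theorem star_add_mul_add_le [PartialOrder A] [StarOrderedRing A] (X Y : A) {δ ρ : ℝ}
    (hδ : 0 < δ) (hρ : 0 < ρ) :
    star (X + Y) * (X + Y) ≤ (1 + ρ / δ) • (star X * X) + (1 + δ / ρ) • (star Y * Y) := by
  have h := star_mul_self_nonneg (Real.sqrt (ρ / δ) • X - Real.sqrt (δ / ρ) • Y)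
  rw [← sub_nonneg]
  convert h using 1
  have e1 : Real.sqrt (ρ / δ) * Real.sqrt (δ / ρ) = 1 := by
    rw [← Real.sqrt_mul (by positivity)]
    rw [show ρ / δ * (δ / ρ) = 1 by field_simp, Real.sqrt_one]
  have e2 : Real.sqrt (ρ / δ) * Real.sqrt (ρ / δ) = ρ / δ := Real.mul_self_sqrt (by positivity)
  have e3 : Real.sqrt (δ / ρ) * Real.sqrt (δ / ρ) = δ / ρ := Real.mul_self_sqrt (by positivity)
  simp only [star_sub, star_add, smul_sub, star_smul, star_trivial, mul_add, mul_sub, add_mul, sub_mul,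
    smul_mul_assoc, mul_smul_comm, smul_smul, e2, e3, mul_comm (Real.sqrt (δ / ρ)), e1,
    add_smul, one_smul]
  abel

/-- The bump function `max(0, 1 - ((y - c)/τ)²)`, with open support `(c - τ, c + τ)`. -/
def quadBump (c τ y : ℝ) : ℝ := max 0 (1 - ((y - c) / τ) ^ 2)

theorem continuous_quadBump (c τ : ℝ) : Continuous (quadBump c τ) := by
  unfold quadBump; fun_prop

theorem quadBump_nonneg (c τ y : ℝ) : 0 ≤ quadBump c τ y := le_max_left _ _

theorem abs_sub_lt_of_quadBump_ne_zero {c τ y : ℝ} (hτ : 0 < τ) (h : quadBump c τ y ≠ 0) :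
    |y - c| < τ := by
  by_contra hcon
  push Not at hcon
  apply h
  apply max_eq_left
  have : 1 ≤ ((y - c) / τ) ^ 2 := by
    rw [← sq_abs, abs_div, abs_of_pos hτ]
    exact one_le_pow₀ ((one_le_div hτ).mpr hcon)
  linarith

/-- If `‖a - b‖ ≤ δ`, the spectral part of `a` in an interval of radius `ρ` is dominated by the
compression of the part of `b` in the concentric interval of radius `τ > ρ + δ`. -/
theorem cuntzLE_of_interval [PartialOrder A] [StarOrderedRing A] {a b : A}
    (ha : IsSelfAdjoint a) (hb : IsSelfAdjoint b) {δ ρ τ c : ℝ} (hδ : 0 < δ) (hρ : 0 < ρ)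
    (hτ : ρ + δ < τ) (hab : ‖b - a‖ ≤ δ) {h : ℝ → ℝ} (hh : Continuous h)
    (hsupp : ∀ x, h x ≠ 0 → |x - c| ≤ ρ) :
    CuntzLE (cfc h a * cfc h a) (cfc (quadBump c τ) b) := by
  set e := cfc h a with he_def
  set G := cfc (quadBump c τ) b with hG_def
  have he : IsSelfAdjoint e := cfc_predicate _ _
  have hτ0 : 0 < τ := by linarith
  set d : A := algebraMap ℝ A c with hd
  have hds : IsSelfAdjoint d := IsSelfAdjoint.algebraMap A (by simp [IsSelfAdjoint])
  -- the two pieces of `(b - c) e = (b - a) e + (a - c) e`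
  have hX : star ((b - a) * e) * ((b - a) * e) ≤ (δ ^ 2) • (e * e) := by
    have h1 : star (b - a) * (b - a) ≤ algebraMap ℝ A (δ ^ 2) := by
      refine CStarAlgebra.star_mul_le_algebraMap_norm_sq.trans ?_
      apply algebraMap_mono A
      gcongr
    have h2 := star_left_conjugate_le_conjugate h1 e
    rw [he.star_eq] at h2
    convert h2 using 1
    · rw [star_mul, he.star_eq]; simp only [mul_assoc]
    · rw [← Algebra.commutes, mul_assoc, Algebra.smul_def]
  have hY : star ((a - d) * e) * ((a - d) * e) ≤ (ρ ^ 2) • (e * e) := by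
    have h1 : (a - d) * e = cfc (fun x => (x - c) * h x) a := by
      rw [cfc_mul _ _ a, cfc_sub_algebraMap ha]
    have h2 : IsSelfAdjoint ((a - d) * e) := by rw [h1]; exact cfc_predicate _ _
    rw [h2.star_eq, h1, ← cfc_mul _ _ a, he_def, ← cfc_mul _ _ a,
      ← cfc_smul (ρ ^ 2) (fun x => h x * h x) a]
    apply cfc_mono
    · intro x _
      by_cases hx : h x = 0
      · simp [hx]
      · have h3 := hsupp x hx
        have h4 : (x - c) ^ 2 ≤ ρ ^ 2 := sq_le_sq' (by linarith [abs_le.mp h3]) (abs_le.mp h3).2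
        simp only [smul_eq_mul]
        nlinarith [mul_self_nonneg (h x)]
    · exact Continuous.continuousOn (by fun_prop)
    · exact Continuous.continuousOn (by fun_prop)
  have hZ : star ((b - d) * e) * ((b - d) * e) ≤ ((ρ + δ) ^ 2) • (e * e) := by
    have h1 : (b - d) * e = (b - a) * e + (a - d) * e := by noncomm_ring
    rw [h1]
    refine (star_add_mul_add_le _ _ hδ hρ).trans ?_
    have h2 : ((ρ + δ) ^ 2) • (e * e) =
        (1 + ρ / δ) • (δ ^ 2 • (e * e)) + (1 + δ / ρ) • (ρ ^ 2 • (e * e)) := by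
      rw [smul_smul, smul_smul, ← add_smul]
      congr 1
      field_simp
      ring
    rw [h2]
    gcongr
  have hG1 : 1 - (τ⁻¹ ^ 2) • (star (b - d) * (b - d)) ≤ G := by
    have h1 : b - d = cfc (fun x => x - c) b := by
      rw [cfc_sub_algebraMap hb]
    have h2 : IsSelfAdjoint (b - d) := hb.sub hds
    rw [h2.star_eq, h1, ← cfc_mul _ _ b, ← cfc_smul (τ⁻¹ ^ 2) (fun x => (x - c) * (x - c)) b,
      ← cfc_one ℝ b, ← cfc_sub _ _ b]
    apply cfc_mono
    · intro x _
      unfold quadBump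
      refine le_trans (le_of_eq ?_) (le_max_right _ _)
      simp only [Pi.one_apply, smul_eq_mul]
      field_simp
    · exact (continuous_const.sub (by fun_prop : Continuous fun x : ℝ =>
        τ⁻¹ ^ 2 • ((x - c) * (x - c)))).continuousOn
    · exact (continuous_quadBump c τ).continuousOn
  have hθ : (0 : ℝ) < 1 - τ⁻¹ ^ 2 * (ρ + δ) ^ 2 := by
    have : τ⁻¹ * (ρ + δ) < 1 := by rw [inv_mul_lt_iff₀ hτ0]; linarith
    have h0 : 0 ≤ τ⁻¹ * (ρ + δ) := by positivity
    nlinarith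
  set θ := 1 - τ⁻¹ ^ 2 * (ρ + δ) ^ 2 with hθ_def
  have hmain : θ • (e * e) ≤ star e * G * e := by
    refine le_trans ?_ (star_left_conjugate_le_conjugate hG1 e)
    have h1 : star e * (1 - (τ⁻¹ ^ 2) • (star (b - d) * (b - d))) * e =
        e * e - (τ⁻¹ ^ 2) • (star ((b - d) * e) * ((b - d) * e)) := by
      rw [mul_sub, sub_mul, he.star_eq, mul_one, mul_smul_comm, smul_mul_assoc, star_mul,
        he.star_eq]
      simp only [mul_assoc]
    rw [h1, hθ_def, sub_smul, one_smul, ← smul_smul]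
    gcongr
  have hGn : 0 ≤ G := cfc_nonneg fun x _ => quadBump_nonneg c τ x
  have hle : e * e ≤ θ⁻¹ • (star e * G * e) := by
    have := smul_le_smul_of_nonneg_left hmain (inv_nonneg.mpr hθ.le)
    rwa [smul_smul, inv_mul_cancel₀ hθ.ne', one_smul] at this
  refine CuntzLE.of_smul_conj (z := e) (inv_nonneg.mpr hθ.le) (cuntzLE_of_mul_self_le he ?_ hle)
  exact smul_nonneg (inv_nonneg.mpr hθ.le) (star_left_conjugate_nonneg hGn e)

/-- Subequivalences below the mutually orthogonal pieces `k_i g k_i` of `g` add up: in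
`Y = ∑ k_i(b) z_i` the cross terms of `Y⋆ g(b) Y` vanish. -/
theorem cuntzLE_sum_of_orthogonal {J : Type*} (s : Finset J) {x : J → A} {b : A} {g : ℝ → ℝ}
    (hg : Continuous g) {k : J → ℝ → ℝ} (hk : ∀ i, Continuous (k i))
    (horth : ∀ i ∈ s, ∀ j ∈ s, i ≠ j → ∀ y, k i y * k j y = 0)
    (h : ∀ i ∈ s, CuntzLE (x i) (cfc (fun y => k i y * g y * k i y) b)) :
    CuntzLE (∑ i ∈ s, x i) (cfc g b) := by
  intro ε hε
  have hε' : 0 < ε / (s.card + 1) := by positivity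
  choose! z hz using fun i hi => h i hi _ hε'
  refine ⟨∑ i ∈ s, cfc (k i) b * z i, ?_⟩
  have hks : ∀ i, IsSelfAdjoint (cfc (k i) b) := fun i => cfc_predicate _ _
  have key : star (∑ i ∈ s, cfc (k i) b * z i) * cfc g b * (∑ i ∈ s, cfc (k i) b * z i) =
      ∑ i ∈ s, star (z i) * cfc (fun y => k i y * g y * k i y) b * z i := by
    rw [star_sum, Finset.sum_mul, Finset.sum_mul]
    refine Finset.sum_congr rfl fun i hi => ?_
    rw [Finset.mul_sum, Finset.sum_eq_single_of_mem i hi]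
    · rw [star_mul, (hks i).star_eq, cfc_mul _ _ b, cfc_mul _ _ b]
      simp only [mul_assoc]
    · intro j hj hji
      have h0 : cfc (k i) b * cfc g b * cfc (k j) b = 0 := by
        rw [← cfc_mul (k i) g b, ← cfc_mul (fun y => k i y * g y) (k j) b (((hk i).mul hg).continuousOn)]
        rw [← cfc_zero ℝ b]
        apply cfc_congr
        intro y _
        simp only [Pi.zero_apply]
        rw [mul_right_comm, horth i hi j hj hji.symm, zero_mul]
      rw [star_mul, (hks i).star_eq]
      calc star (z i) * cfc (k i) b * cfc g b * (cfc (k j) b * z j)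
          = star (z i) * (cfc (k i) b * cfc g b * cfc (k j) b) * z j := by noncomm_ring
        _ = 0 := by rw [h0, mul_zero, zero_mul]
  rw [key, ← Finset.sum_sub_distrib]
  refine (norm_sum_le _ _).trans_lt ?_
  refine (Finset.sum_le_card_nsmul s _ _ fun i hi => (hz i hi).le).trans_lt ?_
  rw [nsmul_eq_mul]
  have : (0 : ℝ) ≤ s.card := by positivity
  rw [mul_div_assoc', div_lt_iff₀ (by positivity)]
  nlinarith

/-- A continuous function which is positive on a compact interval is bounded below there, hence any
continuous `w ≥ 0` supported in the interval can be written `k * g * k`. -/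
theorem exists_continuous_mul_mul_eq {g w : ℝ → ℝ} (hg : Continuous g) (hw : Continuous w)
    (hw0 : ∀ y, 0 ≤ w y) {S : Set ℝ} (hS : IsCompact S) (hpos : ∀ y ∈ S, 0 < g y)
    (hsupp : ∀ y, w y ≠ 0 → y ∈ S) :
    ∃ k : ℝ → ℝ, Continuous k ∧ (∀ y, k y * g y * k y = w y) ∧ ∀ y, k y ≠ 0 → w y ≠ 0 := by
  obtain ⟨m, hm, hmS⟩ : ∃ m : ℝ, 0 < m ∧ ∀ y ∈ S, m ≤ g y := by
    rcases S.eq_empty_or_nonempty with h | h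
    · exact ⟨1, one_pos, by simp [h]⟩
    · obtain ⟨y, hy, hmin⟩ := hS.exists_isMinOn h hg.continuousOn
      exact ⟨g y, hpos y hy, fun z hz => hmin hz⟩
  refine ⟨fun y => Real.sqrt (w y / max (g y) m), ?_, ?_, ?_⟩
  · apply Real.continuous_sqrt.comp
    apply hw.div (hg.max continuous_const)
    intro y
    exact (lt_of_lt_of_le hm (le_max_right _ _)).ne'
  · intro y
    by_cases hy : w y = 0
    · simp [hy]
    · have h1 := hsupp y hy
      have h2 := hpos y h1
      simp only
      rw [max_eq_left (hmS y h1), mul_right_comm, Real.mul_self_sqrt (div_nonneg (hw0 y) h2.le)]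
      field_simp
  · intro y hy h0
    simp [h0] at hy

/-- A compact `K ⊆ ℝ` splits into finitely many clusters, each contained in an interval
`[c - ρ, c + ρ]`, in such a way that the intervals `(c - ρ - r, c + ρ + r)` are pairwise disjoint
and contained in the open `r`-neighbourhood of `K`: the clusters are the intersections of `K` with
the connected components of that neighbourhood. -/
theorem IsCompact.exists_clusters {K : Set ℝ} (hK : IsCompact K) {r : ℝ} (hr : 0 < r) :
    ∃ (s : Finset (Set ℝ)) (c ρ : Set ℝ → ℝ), (∀ C ∈ s, 0 ≤ ρ C) ∧
      (∀ x ∈ K, ∃ C ∈ s, |x - c C| ≤ ρ C) ∧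
      (∀ C ∈ s, ∀ x, |x - c C| < ρ C + r → x ∈ C ∧ x ∈ Metric.thickening r K) ∧
      (∀ C ∈ s, ∀ D ∈ s, C ≠ D → Disjoint C D) := by
  set V := Metric.thickening r K with hV
  have hVo : IsOpen V := Metric.isOpen_thickening
  have hKV : K ⊆ V := Metric.self_subset_thickening hr K
  obtain ⟨t, htK, ht⟩ := hK.elim_nhds_subcover (fun x => connectedComponentIn V x) fun x hx =>
    (hVo.connectedComponentIn).mem_nhds (mem_connectedComponentIn (hKV hx))
  set s : Finset (Set ℝ) := t.image fun x => connectedComponentIn V x with hs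
  have hmem : ∀ C ∈ s, ∀ y ∈ C, C = connectedComponentIn V y := by
    intro C hC y hy
    obtain ⟨x, hx, rfl⟩ := Finset.mem_image.mp hC
    exact connectedComponentIn_eq hy
  have hdisj : ∀ C ∈ s, ∀ D ∈ s, C ≠ D → Disjoint C D := by
    intro C hC D hD hne
    rw [Set.disjoint_left]
    intro y hyC hyD
    exact hne ((hmem C hC y hyC).trans (hmem D hD y hyD).symm)
  have hopen : ∀ C ∈ s, IsOpen C := by
    intro C hC
    obtain ⟨x, hx, rfl⟩ := Finset.mem_image.mp hC
    exact hVo.connectedComponentIn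
  have hne : ∀ C ∈ s, (K ∩ C).Nonempty := by
    intro C hC
    obtain ⟨x, hx, rfl⟩ := Finset.mem_image.mp hC
    exact ⟨x, htK x hx, mem_connectedComponentIn (hKV (htK x hx))⟩
  have hcov : ∀ x ∈ K, ∃ C ∈ s, x ∈ C := by
    intro x hx
    obtain ⟨y, hy, hxy⟩ := Set.mem_iUnion₂.mp (ht hx)
    exact ⟨_, Finset.mem_image_of_mem _ hy, hxy⟩
  have hcpt : ∀ C ∈ s, IsCompact (K ∩ C) := by
    intro C hC
    have : K ∩ C = K \ ⋃ D ∈ s.erase C, D := by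
      ext x
      simp only [Set.mem_inter_iff, Set.mem_sdiff, Set.mem_iUnion, Finset.mem_erase, not_exists]
      constructor
      · rintro ⟨hxK, hxC⟩
        exact ⟨hxK, fun D hD hxD => Set.disjoint_left.mp (hdisj C hC D hD.2 hD.1.symm) hxC hxD⟩
      · rintro ⟨hxK, hxn⟩
        obtain ⟨D, hD, hxD⟩ := hcov x hxK
        by_cases hDC : D = C
        · exact ⟨hxK, hDC ▸ hxD⟩
        · exact absurd hxD (hxn D ⟨hDC, hD⟩)
    rw [this]
    exact hK.diff (isOpen_biUnion fun D hD => hopen D (Finset.mem_of_mem_erase hD))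
  refine ⟨s, fun C => (sInf (K ∩ C) + sSup (K ∩ C)) / 2, fun C => (sSup (K ∩ C) - sInf (K ∩ C)) / 2,
    ?_, ?_, ?_, hdisj⟩
  · intro C hC
    have := Real.sInf_le_sSup (K ∩ C) (hcpt C hC).bddBelow (hcpt C hC).bddAbove
    simp only
    linarith
  · intro x hx
    obtain ⟨C, hC, hxC⟩ := hcov x hx
    refine ⟨C, hC, ?_⟩
    have h1 := csInf_le (hcpt C hC).bddBelow ⟨hx, hxC⟩
    have h2 := le_csSup (hcpt C hC).bddAbove ⟨hx, hxC⟩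
    rw [abs_le]
    constructor <;> linarith
  · intro C hC x hx
    set p := sInf (K ∩ C)
    set q := sSup (K ∩ C)
    have hp : p ∈ K ∩ C := (hcpt C hC).sInf_mem (hne C hC)
    have hq : q ∈ K ∩ C := (hcpt C hC).sSup_mem (hne C hC)
    have hord : C.OrdConnected := by
      rw [hmem C hC p hp.2]
      exact isPreconnected_connectedComponentIn.ordConnected
    have hball : ∀ z ∈ K ∩ C, ∀ y, |y - z| < r → y ∈ C := by
      intro z hz y hy
      have h1 : Metric.ball z r ⊆ V := Metric.ball_subset_thickening hz.1 r
      have h2 : Metric.ball z r ⊆ connectedComponentIn V z :=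
        (convex_ball z r).isPreconnected.subset_connectedComponentIn (Metric.mem_ball_self hr) h1
      rw [hmem C hC z hz.2]
      exact h2 (by rwa [Metric.mem_ball, Real.dist_eq])
    have hxC : x ∈ C := by
      rw [abs_lt] at hx
      rcases lt_or_ge x p with h | h
      · exact hball p hp x (by rw [abs_lt]; constructor <;> linarith)
      · rcases lt_or_ge q x with h' | h'
        · exact hball q hq x (by rw [abs_lt]; constructor <;> linarith)
        · exact hord.out hp.2 hq.2 ⟨h, h'⟩
    refine ⟨hxC, ?_⟩
    have : C ⊆ V := by
      rw [hmem C hC p hp.2]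
      exact connectedComponentIn_subset V p
    exact this hxC

/-- If `‖b - a‖ < r` and `g` is positive on the `r`-neighbourhood of the open support of `f`, then
`f(a) ≾ g(b)`. -/
theorem cuntzLE_cfc_of_norm_sub_lt [PartialOrder A] [StarOrderedRing A] {a b : A}
    (ha : IsSelfAdjoint a) (hb : IsSelfAdjoint b) {r : ℝ} (hab : ‖b - a‖ < r) {f g : ℝ → ℝ}
    (hf : Continuous f) (hg : Continuous g)
    (hfg : ∀ y ∈ Metric.thickening r {x | 0 < f x}, 0 < g y) (hf0 : ∀ x, 0 ≤ f x) :
    CuntzLE (cfc f a) (cfc g b) := by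
  have hr : 0 < r := (norm_nonneg _).trans_lt hab
  intro ε hε
  set ε' := ε / 3 with hε'
  have hε0 : 0 < ε' := by positivity
  set K : Set ℝ := spectrum ℝ a ∩ {x | ε' ≤ f x} with hKdef
  have hK : IsCompact K :=
    (ContinuousFunctionalCalculus.isCompact_spectrum a).inter_right
      (isClosed_le continuous_const hf)
  obtain ⟨s, c, ρ, hρ0, hcov, hsub, hdisj⟩ := hK.exists_clusters hr
  obtain ⟨t, ht, hδ⟩ : ∃ t : ℝ, 0 < t ∧ ‖b - a‖ + 5 * t < r :=
    ⟨(r - ‖b - a‖) / 6, by linarith, by linarith⟩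
  -- square roots of the pieces of `(f - ε')₊`; the margin `t` leaves room for `bump` to decrease from
  -- `1` to `0` outside the clusters
  set bump : Set ℝ → ℝ → ℝ := fun C x => max 0 (1 - max 0 (|x - c C| - ρ C) / t) with hbump
  set h : Set ℝ → ℝ → ℝ := fun C x => Real.sqrt (max (f x - ε') 0) * bump C x with hh
  have hbc : ∀ C, Continuous (bump C) := fun C => by simp only [hbump]; fun_prop
  have hhc : ∀ C, Continuous (h C) := fun C =>
    (Real.continuous_sqrt.comp (by fun_prop)).mul (hbc C)
  have hb0 : ∀ C x, bump C x ≠ 0 → |x - c C| ≤ ρ C + t := by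
    intro C x hx
    by_contra hcon
    push Not at hcon
    apply hx
    apply max_eq_left
    have h1 : t ≤ max 0 (|x - c C| - ρ C) := le_max_of_le_right (by linarith)
    have h2 : 1 ≤ max 0 (|x - c C| - ρ C) / t := (one_le_div ht).mpr h1
    linarith
  have hb1 : ∀ C x, |x - c C| ≤ ρ C → bump C x = 1 := by
    intro C x hx
    simp only [hbump]
    rw [max_eq_left (by linarith : |x - c C| - ρ C ≤ 0)]
    simp
  set τ : Set ℝ → ℝ := fun C => ρ C + ‖b - a‖ + 3 * t with hτ
  have hτ0 : ∀ C ∈ s, 0 < τ C := fun C hC => by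
    have := hρ0 C hC
    have := norm_nonneg (b - a)
    simp only [hτ]; linarith
  have hk : ∀ C ∈ s, ∃ k : ℝ → ℝ, Continuous k ∧
      (∀ y, k y * g y * k y = quadBump (c C) (τ C) y) ∧
      ∀ y, k y ≠ 0 → quadBump (c C) (τ C) y ≠ 0 := by
    intro C hC
    refine exists_continuous_mul_mul_eq hg (continuous_quadBump _ _) (quadBump_nonneg _ _)
      (isCompact_closedBall (c C) (τ C)) ?_ ?_
    · intro y hy
      rw [Metric.mem_closedBall, Real.dist_eq] at hy
      refine hfg y (Metric.thickening_subset_of_subset r ?_ (hsub C hC y ?_).2)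
      · intro x hx
        exact hε0.trans_le hx.2
      · simp only [hτ] at hy
        linarith
    · intro y hy
      rw [Metric.mem_closedBall, Real.dist_eq]
      exact (abs_sub_lt_of_quadBump_ne_zero (hτ0 C hC) hy).le
  choose! k hkc hkg hk0 using hk
  have hk' : ∀ C, Continuous (if C ∈ s then k C else 0) := by
    intro C
    by_cases hC : C ∈ s
    · simpa [hC] using hkc C hC
    · simpa [hC] using continuous_zero
  have hsum : CuntzLE (∑ C ∈ s, cfc (h C) a * cfc (h C) a) (cfc g b) := by
    refine cuntzLE_sum_of_orthogonal s hg hk' ?_ ?_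
    · intro C hC D hD hCD y
      simp only [hC, hD, if_true]
      by_contra hne
      have h1 := hk0 C hC y (left_ne_zero_of_mul hne)
      have h2 := hk0 D hD y (right_ne_zero_of_mul hne)
      have h3 := abs_sub_lt_of_quadBump_ne_zero (hτ0 C hC) h1
      have h4 := abs_sub_lt_of_quadBump_ne_zero (hτ0 D hD) h2
      refine Set.disjoint_left.mp (hdisj C hC D hD hCD) (hsub C hC y ?_).1 (hsub D hD y ?_).1 <;>
      · simp only [hτ] at h3 h4
        linarith
    · intro C hC
      have h1 : (fun y => (if C ∈ s then k C else 0) y * g y * (if C ∈ s then k C else 0) y) =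
          quadBump (c C) (τ C) := by
        funext y
        simpa [hC] using hkg C hC y
      rw [h1]
      have hρC := hρ0 C hC
      have hn := norm_nonneg (b - a)
      refine cuntzLE_of_interval ha hb (δ := ‖b - a‖ + t) (ρ := ρ C + t) (by linarith)
        (by linarith) ?_ (by linarith) (hhc C) ?_
      · simp only [hτ]; linarith
      · intro x hx
        exact hb0 C x (right_ne_zero_of_mul hx)
  have hsq : ∑ C ∈ s, cfc (h C) a * cfc (h C) a = cfc (fun x => max (f x - ε') 0) a := by
    have h1 : ∀ C ∈ s, cfc (h C) a * cfc (h C) a = cfc (fun x => h C x * h C x) a := fun C _ =>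
      (cfc_mul _ _ a (hhc C).continuousOn (hhc C).continuousOn).symm
    rw [Finset.sum_congr rfl h1, ← cfc_sum (fun C x => h C x * h C x) a s
      (fun C _ => ((hhc C).mul (hhc C)).continuousOn)]
    apply cfc_congr
    intro x hx
    simp only [Finset.sum_apply]
    have h2 : ∀ C, h C x * h C x = max (f x - ε') 0 * (bump C x * bump C x) := by
      intro C
      simp only [hh]
      rw [mul_mul_mul_comm, Real.mul_self_sqrt (le_max_right _ _)]
    simp only [h2]
    rcases le_or_gt (f x) ε' with hle | hlt
    · simp [max_eq_right (by linarith : f x - ε' ≤ 0)]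
    · obtain ⟨C, hC, hxC⟩ := hcov x ⟨hx, hlt.le⟩
      rw [Finset.sum_eq_single_of_mem C hC]
      · rw [hb1 C x hxC]; ring
      · intro D hD hDC
        by_contra hne
        have h3 := hb0 D x (left_ne_zero_of_mul (right_ne_zero_of_mul hne))
        have := norm_nonneg (b - a)
        exact Set.disjoint_left.mp (hdisj D hD C hC hDC) (hsub D hD x (by linarith)).1
          (hsub C hC x (by linarith)).1
  rw [hsq] at hsum
  obtain ⟨x, hx⟩ := hsum ε' hε0
  refine ⟨x, ?_⟩
  have hdist : ‖cfc (fun x => max (f x - ε') 0) a - cfc f a‖ ≤ ε' := by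
    rw [← cfc_sub _ _ a (by fun_prop) hf.continuousOn]
    apply norm_cfc_le hε0.le
    intro y _
    rw [Real.norm_eq_abs, abs_le]
    have := hf0 y
    rcases le_total (f y - ε') 0 with h1 | h1
    · rw [max_eq_right h1]; constructor <;> linarith
    · rw [max_eq_left h1]; constructor <;> linarith
  calc ‖star x * cfc g b * x - cfc f a‖
      ≤ ‖star x * cfc g b * x - cfc (fun x => max (f x - ε') 0) a‖ +
        ‖cfc (fun x => max (f x - ε') 0) a - cfc f a‖ := norm_sub_le_norm_sub_add_norm_sub _ _ _
    _ < ε := by linarith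

end CuntzComparison

/-! ### The Cuntz distance is at most the unitary distance -/

section UnitaryDistance

/-- On self-adjoint elements the complex functional calculus of the definition of `OpenCuntzLE` is the
real one. -/
theorem cfc_ofReal_eq_cfc_real {A : Type*} [CStarAlgebra A] {a : A} (ha : IsSelfAdjoint a)
    (f : ℂ → ℝ) : cfc (fun z : ℂ => (f z : ℂ)) a = cfc (fun x : ℝ => f x) a := by
  rw [cfc_complex_eq_real a (by simp) ha]
  simp

theorem CuntzLE.conj {A : Type*} [CStarAlgebra A] {p q : A} (h : CuntzLE p q) {u : A}
    (hu : u ∈ unitary A) : CuntzLE (u * p * star u) q := by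
  intro ε hε
  obtain ⟨x, hx⟩ := h ε hε
  refine ⟨x * star u, ?_⟩
  have h1 : star (x * star u) * q * (x * star u) - u * p * star u =
      u * (star x * q * x - p) * star u := by
    rw [star_mul, star_star]; noncomm_ring
  have h2 : star u ∈ unitary A := Unitary.star_mem hu
  rwa [h1, CStarRing.norm_mul_mem_unitary _ h2, CStarRing.norm_mem_unitary_mul _ hu]

theorem CuntzLE.conj_right {A : Type*} [CStarAlgebra A] {p q : A} (h : CuntzLE p q) {u : A}
    (hu : u ∈ unitary A) : CuntzLE p (u * q * star u) := by
  intro ε hε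
  obtain ⟨x, hx⟩ := h ε hε
  refine ⟨u * x, ?_⟩
  convert hx using 3
  have h1 := Unitary.star_mul_self_of_mem hu
  rw [star_mul]
  calc star x * star u * (u * q * star u) * (u * x)
      = star x * (star u * u) * q * (star u * u) * x := by noncomm_ring
    _ = _ := by rw [h1]; noncomm_ring

theorem cfc_conj_unitary {A : Type*} [CStarAlgebra A] {a : A} (ha : IsSelfAdjoint a) {u : A}
    (hu : u ∈ unitary A) {f : ℝ → ℝ} (hf : Continuous f) :
    cfc f (u * a * star u) = u * cfc f a * star u := by
  have h := StarAlgHomClass.map_cfc (Unitary.conjStarAlgAut ℂ A ⟨u, hu⟩) f a hf.continuousOn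
    (by
      have : ⇑(Unitary.conjStarAlgAut ℂ A ⟨u, hu⟩) = fun x => u * x * star u := by
        funext x; simp [Unitary.conjStarAlgAut_apply]
      rw [this]; fun_prop) ha (ha.map _)
  simpa [Unitary.conjStarAlgAut_apply] using h.symm

/-- Only real spectrum matters, and the real `r`-neighbourhood of `U ∩ ℝ` is contained in the
`r`-neighbourhood of `U` in `ℂ`. -/
theorem openCuntzLE_of_norm_lt {B : Type*} [NonUnitalCStarAlgebra B] {a b : B}
    (ha : IsSelfAdjoint a) (hb : IsSelfAdjoint b) {u : Unitization ℂ B}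
    (hu : u ∈ unitary (Unitization ℂ B)) {r : ℝ}
    (h : ‖u * (a : Unitization ℂ B) * star u - (b : Unitization ℂ B)‖ < r) (U : Set ℂ) :
    OpenCuntzLE U (Metric.thickening r U) a b ∧ OpenCuntzLE U (Metric.thickening r U) b a := by
  let _ := CStarAlgebra.spectralOrder (Unitization ℂ B)
  have := CStarAlgebra.spectralOrderedRing (Unitization ℂ B)
  have ha' : IsSelfAdjoint (a : Unitization ℂ B) := ha.inr ℂ
  have hb' : IsSelfAdjoint (b : Unitization ℂ B) := hb.inr ℂ
  have hc : IsSelfAdjoint (u * (a : Unitization ℂ B) * star u) := ha'.conjugate u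
  have key : ∀ f g : C(ℂ, ℝ), 0 ≤ f → 0 ≤ g → Function.support f = U →
      Function.support g = Metric.thickening r U →
      (Continuous fun x : ℝ => f x) ∧ (Continuous fun x : ℝ => g x) ∧
      (∀ y ∈ Metric.thickening r {x : ℝ | 0 < f x}, 0 < g y) ∧ ∀ x : ℝ, 0 ≤ f x := by
    intro f g hf hg hfU hgU
    refine ⟨by fun_prop, by fun_prop, ?_, fun x => hf x⟩
    intro y hy
    refine lt_of_le_of_ne (hg y) (Ne.symm ?_)
    change (y : ℂ) ∈ Function.support g
    rw [hgU]
    obtain ⟨x, hx, hxy⟩ := Metric.mem_thickening_iff.mp hy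
    refine Metric.mem_thickening_iff.mpr ⟨(x : ℂ), ?_, ?_⟩
    · rw [← hfU]; exact (show 0 < f x from hx).ne'
    · rw [Complex.dist_eq, ← Complex.ofReal_sub, Complex.norm_real]
      rwa [Real.dist_eq] at hxy
  constructor
  · intro f g hf hg hfU hgU
    obtain ⟨h1, h2, h3, h4⟩ := key f g hf hg hfU hgU
    rw [cfc_ofReal_eq_cfc_real ha', cfc_ofReal_eq_cfc_real hb']
    rw [norm_sub_rev] at h
    have h5 := cuntzLE_cfc_of_norm_sub_lt hc hb' h h1 h2 h3 h4
    rw [cfc_conj_unitary ha' hu h1] at h5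
    have h6 := h5.conj (Unitary.star_mem hu)
    have h7 := Unitary.star_mul_self_of_mem hu
    rw [star_star] at h6
    convert h6 using 1
    calc cfc (fun x : ℝ => f x) (a : Unitization ℂ B)
        = 1 * cfc (fun x : ℝ => f x) (a : Unitization ℂ B) * 1 := by simp
      _ = _ := by rw [← h7]; noncomm_ring
  · intro f g hf hg hfU hgU
    obtain ⟨h1, h2, h3, h4⟩ := key f g hf hg hfU hgU
    rw [cfc_ofReal_eq_cfc_real ha', cfc_ofReal_eq_cfc_real hb']
    have h5 := cuntzLE_cfc_of_norm_sub_lt hb' hc h h1 h2 h3 h4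
    rw [cfc_conj_unitary ha' hu h2] at h5
    have h6 := h5.conj_right (Unitary.star_mem hu)
    have h7 := Unitary.star_mul_self_of_mem hu
    rw [star_star] at h6
    convert h6 using 1
    calc cfc (fun x : ℝ => g x) (a : Unitization ℂ B)
        = 1 * cfc (fun x : ℝ => g x) (a : Unitization ℂ B) * 1 := by simp
      _ = _ := by rw [← h7]; noncomm_ring

theorem cuntzDistElem_le_enorm {B : Type*} [NonUnitalCStarAlgebra B] {a b : B}
    (ha : IsSelfAdjoint a) (hb : IsSelfAdjoint b) (u : unitary (Unitization ℂ B)) :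
    cuntzDistElem a b ≤ ‖(u : Unitization ℂ B) * (a : Unitization ℂ B) *
      star (u : Unitization ℂ B) - (b : Unitization ℂ B)‖ₑ := by
  refine iSup₂_le fun U _ => ?_
  refine ENNReal.le_of_forall_pos_le_add fun ε hε _ => ?_
  set t := ‖(u : Unitization ℂ B) * (a : Unitization ℂ B) *
      star (u : Unitization ℂ B) - (b : Unitization ℂ B)‖ with ht
  have hr : t < t + ε := by
    have : (0 : ℝ) < ε := hε
    linarith
  refine (iInf₂_le_of_le (t + ε) ((norm_nonneg _).trans_lt hr)
    (iInf_le _ (openCuntzLE_of_norm_lt ha hb u.2 hr U))).trans ?_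
  rw [ENNReal.ofReal_add (ht ▸ norm_nonneg _) ε.coe_nonneg, ENNReal.ofReal_coe_nnreal, ht, ofReal_norm]

theorem cuntzDist_le_unitaryDist {A B : Type*} [NonUnitalCStarAlgebra A] [NonUnitalCStarAlgebra B]
    {L : Set A} (hL : ∀ f ∈ L, IsSelfAdjoint f) (φ ψ : A →⋆ₙₐ[ℂ] B) :
    cuntzDist L φ ψ ≤ unitaryDist L φ ψ := by
  refine iSup₂_le fun f hf => ?_
  refine le_iSup₂_of_le ({f} : Finset A) (by simpa using hf) (le_iInf fun u => ?_)
  simp only [Finset.mem_singleton, iSup_iSup_eq_left]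
  exact cuntzDistElem_le_enorm ((hL f hf).map φ) ((hL f hf).map ψ) u

end UnitaryDistance

/-! ### Cancellation of multiplicity for families of matrices -/

section Cancellation

open Matrix

variable {κ : Type*} [Fintype κ] [DecidableEq κ]

theorem Matrix.continuousOn_spectrum_real (a : Matrix κ κ ℂ) (f : ℝ → ℝ) :
    ContinuousOn f (spectrum ℝ a) :=
  a.finite_real_spectrum.continuousOn f

/-- The orthogonal projection onto the kernel of a self-adjoint matrix `a`, as a function of `a`. -/
theorem Matrix.exists_ker_projection {a : Matrix κ κ ℂ} (ha : IsSelfAdjoint a) :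
    ∃ p : Matrix κ κ ℂ, IsSelfAdjoint p ∧ a * p = 0 ∧ (∀ v, a *ᵥ v = 0 → p *ᵥ v = v) ∧
      ∀ x, Commute a x → Commute p x := by
  refine ⟨cfc (fun x : ℝ => if x = 0 then 1 else 0) a, cfc_predicate _ _, ?_, ?_,
    fun x hx => hx.cfc_real _⟩
  · have h1 : a * cfc (fun x : ℝ => if x = 0 then 1 else 0) a =
        cfc (fun x : ℝ => x) a * cfc (fun x : ℝ => if x = 0 then 1 else 0) a := by
      rw [cfc_id' ℝ a]
    rw [h1, ← cfc_mul _ _ a (a.continuousOn_spectrum_real _) (a.continuousOn_spectrum_real _),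
      ← cfc_zero ℝ a]
    apply cfc_congr
    intro x _
    by_cases h : x = 0 <;> simp [h]
  · intro v hv
    have h1 : cfc (fun x : ℝ => if x = 0 then 1 else 0) a + cfc (fun x : ℝ => x⁻¹) a * a = 1 := by
      have h2 : cfc (fun x : ℝ => x⁻¹) a * a = cfc (fun x : ℝ => x⁻¹ * x) a := by
        rw [cfc_mul _ _ a (a.continuousOn_spectrum_real _) (a.continuousOn_spectrum_real _),
          cfc_id' ℝ a]
      rw [h2, ← cfc_add a _ _ (a.continuousOn_spectrum_real _) (a.continuousOn_spectrum_real _),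
        ← cfc_one ℝ a]
      apply cfc_congr
      intro x _
      by_cases h : x = 0 <;> simp [h]
    have h2 := congrArg (fun m => m *ᵥ v) h1
    simpa only [one_mulVec, add_mulVec, ← mulVec_mulVec, hv, mulVec_zero, add_zero] using h2

/-- Simultaneous unitary equivalence of a `⋆`-closed family of pairs of matrices can be tested after
amplification by `ν`: if the blocks of an invertible matrix `Q` over `κ × ν` all intertwine the
family, then some unitary matrix over `κ` does.

Take an intertwiner `T` of least nullity, and let `W₁`, `W₂` be the spans of `M (ker T)` and
`H (ker T)`, where `M` is the commutant of the first family and `H` the space of intertwiners. If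
`S ∈ H` did not map `ker T` into the range of `T`, then adding the off-diagonal corner `g S e` of
`S` to `T` would lower the nullity. So `T⋆` embeds `W₂` in the part of `W₁` orthogonal to `ker T`,
whence `dim W₂ + dim ker T ≤ dim W₁`, while `Q` gives `dim W₁ ≤ dim W₂`. Therefore `T` is invertible
and its polar part is the required unitary. -/
theorem Matrix.exists_unitary_intertwiner {ν : Type*} [Fintype ν] [DecidableEq ν] [Nonempty ν]
    (𝒟 : Set (Matrix κ κ ℂ × Matrix κ κ ℂ)) (hstar : ∀ d ∈ 𝒟, (d.1ᴴ, d.2ᴴ) ∈ 𝒟)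
    (Q : Matrix (κ × ν) (κ × ν) ℂ) (hQ : ∀ v, Q *ᵥ v = 0 → v = 0)
    (hint : ∀ d ∈ 𝒟, ∀ i j : ν, Q.submatrix (·, i) (·, j) * d.1 = d.2 * Q.submatrix (·, i) (·, j)) :
    ∃ β ∈ unitaryGroup κ ℂ, ∀ d ∈ 𝒟, β * d.1 = d.2 * β := by
  set H : Set (Matrix κ κ ℂ) := {T | ∀ d ∈ 𝒟, T * d.1 = d.2 * T} with hH
  set M : Set (Matrix κ κ ℂ) := {T | ∀ d ∈ 𝒟, Commute T d.1} with hM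
  have hHadj : ∀ T ∈ H, ∀ d ∈ 𝒟, Tᴴ * d.2 = d.1 * Tᴴ := by
    intro T hT d hd
    have h1 := congrArg conjTranspose (hT _ (hstar d hd))
    simpa [conjTranspose_mul] using h1.symm
  have hHH : ∀ T ∈ H, ∀ S ∈ H, Tᴴ * S ∈ M := by
    intro T hT S hS d hd
    rw [commute_iff_eq, mul_assoc, hS d hd, ← mul_assoc, hHadj T hT d hd, mul_assoc]
  have hHM : ∀ T ∈ H, ∀ S ∈ M, T * S ∈ H := by
    intro T hT S hS d hd
    rw [mul_assoc, (hS d hd).eq, ← mul_assoc, hT d hd, mul_assoc]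
  have hQH : ∀ i j : ν, Q.submatrix (·, i) (·, j) ∈ H := fun i j d hd => hint d hd i j
  have h1M : (1 : Matrix κ κ ℂ) ∈ M := fun d _ => Commute.one_left _
  -- an intertwiner of least possible nullity
  obtain ⟨T, hT, hmin⟩ := (measure fun T : Matrix κ κ ℂ =>
    Module.finrank ℂ (LinearMap.ker T.mulVecLin)).wf.has_min H ⟨0, fun d _ => by simp⟩
  obtain ⟨e, hes, hTe, hev, hec⟩ := exists_ker_projection
    (a := Tᴴ * T) (by rw [← star_eq_conjTranspose]; exact .star_mul_self T)
  obtain ⟨g, hgs, hTg, hgv, hgc⟩ := exists_ker_projection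
    (a := T * Tᴴ) (by rw [← star_eq_conjTranspose]; exact .mul_star_self T)
  have hgT : g * T = 0 := by
    rw [← CStarRing.mul_star_self_eq_zero_iff, star_eq_conjTranspose, conjTranspose_mul,
      ← star_eq_conjTranspose g, hgs.star_eq,
      mul_assoc, ← mul_assoc T, hTg, mul_zero]
  have heM : e ∈ M := fun d hd => hec _ (hHH T hT T hT d hd)
  have hgN : ∀ d ∈ 𝒟, g * d.2 = d.2 * g := fun d hd => hgc _ (by
    rw [commute_iff_eq, mul_assoc, hHadj T hT d hd, ← mul_assoc, hT d hd, mul_assoc])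
  -- minimality of the nullity: `T + g S e` is again an intertwiner, with kernel inside that of `T`
  have hkey : ∀ S ∈ H, ∀ v, T *ᵥ v = 0 → g *ᵥ (S *ᵥ v) = 0 := by
    intro S hS v hv
    by_contra hne
    have hR : g * S * e ∈ H := by
      refine hHM _ ?_ e heM
      intro d hd
      rw [mul_assoc, hS d hd, ← mul_assoc, hgN d hd, mul_assoc]
    have hTR : T + g * S * e ∈ H := by
      intro d hd
      rw [add_mul, mul_add, hT d hd, hR d hd]
    have hev' : ∀ w, T *ᵥ w = 0 → e *ᵥ w = w := fun w hw =>
      hev w (by rw [← mulVec_mulVec, hw, mulVec_zero])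
    have hgg : ∀ w, g *ᵥ (g *ᵥ w) = g *ᵥ w := by
      intro w
      apply hgv
      rw [mulVec_mulVec, hTg, zero_mulVec]
    refine hmin _ hTR (Submodule.finrank_lt_finrank_of_lt (lt_of_le_of_ne ?_ ?_))
    · intro w hw
      simp only [LinearMap.mem_ker, mulVecLin_apply, add_mulVec] at hw ⊢
      have h1 := congrArg (g *ᵥ ·) hw
      simp only [mulVec_add, mulVec_zero, mulVec_mulVec, hgT, zero_mulVec, zero_add] at h1
      rw [← mul_assoc, ← mul_assoc, mul_assoc, ← mulVec_mulVec, ← mulVec_mulVec, hgg,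
        mulVec_mulVec, ← mul_assoc] at h1
      rw [h1, add_zero] at hw
      exact hw
    · intro heq
      have h1 : v ∈ LinearMap.ker (T + g * S * e).mulVecLin := by
        rw [heq]; simpa using hv
      simp only [LinearMap.mem_ker, mulVecLin_apply, add_mulVec, hv, zero_add,
        ← mulVec_mulVec, hev' v hv] at h1
      exact hne h1
  set W₁ : Submodule ℂ (κ → ℂ) := Submodule.span ℂ {w | ∃ S ∈ M, ∃ v, T *ᵥ v = 0 ∧ w = S *ᵥ v}
    with hW₁
  set W₂ : Submodule ℂ (κ → ℂ) := Submodule.span ℂ {w | ∃ S ∈ H, ∃ v, T *ᵥ v = 0 ∧ w = S *ᵥ v}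
    with hW₂
  have hgW₂ : ∀ w ∈ W₂, g *ᵥ w = 0 := by
    intro w hw
    have h1 : W₂ ≤ LinearMap.ker g.mulVecLin := by
      rw [hW₂, Submodule.span_le]
      rintro _ ⟨S, hS, v, hv, rfl⟩
      simpa using hkey S hS v hv
    simpa using h1 hw
  have hHW : ∀ S ∈ H, ∀ w ∈ W₁, S *ᵥ w ∈ W₂ := by
    intro S hS w hw
    have h1 : W₁ ≤ W₂.comap S.mulVecLin := by
      rw [hW₁, Submodule.span_le]
      rintro _ ⟨R, hR, v, hv, rfl⟩
      exact Submodule.subset_span ⟨S * R, hHM S hS R hR, v, hv, by simp⟩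
    exact h1 hw
  have hTW : W₂ ≤ W₁.comap Tᴴ.mulVecLin := by
    rw [hW₂, Submodule.span_le]
    rintro _ ⟨S, hS, v, hv, rfl⟩
    exact Submodule.subset_span ⟨Tᴴ * S, hHH T hT S hS, v, hv, by simp⟩
  have hinj : ∀ w ∈ W₂, Tᴴ *ᵥ w = 0 → w = 0 := by
    intro w hw h0
    rw [← hgv w (by rw [← mulVec_mulVec, h0, mulVec_zero]), hgW₂ w hw]
  -- `Tᴴ` embeds `W₂` into `W₁`, with range orthogonal to the kernel of `T`
  have hdim₁ : Module.finrank ℂ W₂ + Module.finrank ℂ (LinearMap.ker T.mulVecLin) ≤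
      Module.finrank ℂ W₁ := by
    have h1 : Module.finrank ℂ (W₂.map Tᴴ.mulVecLin) = Module.finrank ℂ W₂ := by
      apply LinearEquiv.finrank_eq
      refine (LinearEquiv.ofBijective (Tᴴ.mulVecLin.submoduleMap W₂)
        ⟨?_, LinearMap.submoduleMap_surjective _ _⟩).symm
      rw [← LinearMap.ker_eq_bot, LinearMap.ker_eq_bot']
      rintro ⟨w, hw⟩ h0
      have h2 := congrArg Subtype.val h0
      simp only [LinearMap.submoduleMap_coe_apply, mulVecLin_apply, ZeroMemClass.coe_zero] at h2
      exact Subtype.ext (hinj w hw h2)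
    have h2 : W₂.map Tᴴ.mulVecLin ⊓ LinearMap.ker T.mulVecLin = ⊥ := by
      rw [Submodule.eq_bot_iff]
      rintro _ ⟨⟨w, hw, rfl⟩, h0⟩
      replace h0 : T *ᵥ (Tᴴ *ᵥ w) = 0 := h0
      rw [mulVec_mulVec] at h0
      have h3 := hgv w h0
      rw [hgW₂ w hw] at h3
      rw [← h3, map_zero]
    have h3 := Submodule.finrank_sup_add_finrank_inf_eq (W₂.map Tᴴ.mulVecLin)
      (LinearMap.ker T.mulVecLin)
    rw [h2, finrank_bot, add_zero, h1] at h3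
    rw [← h3]
    apply Submodule.finrank_mono
    rw [sup_le_iff]
    refine ⟨Submodule.map_le_iff_le_comap.mpr hTW, fun v hv => ?_⟩
    exact Submodule.subset_span ⟨1, h1M, v, by simpa using hv, by simp⟩
  -- `Q` embeds `W₁ ^ ν` into `W₂ ^ ν`
  have hdim₂ : Module.finrank ℂ W₁ ≤ Module.finrank ℂ W₂ := by
    let Ψ : (ν → W₁) →ₗ[ℂ] (ν → W₂) := LinearMap.pi fun i => ∑ j,
      ((Q.submatrix (·, i) (·, j)).mulVecLin.restrict (hHW _ (hQH i j))) ∘ₗ LinearMap.proj j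
    have hΨ : Function.Injective Ψ := by
      rw [← LinearMap.ker_eq_bot, LinearMap.ker_eq_bot']
      intro w hw
      have h1 : (fun x : κ × ν => (w x.2 : κ → ℂ) x.1) = 0 := by
        apply hQ
        funext x
        have h2 := congrArg (fun y => (y x.2 : κ → ℂ) x.1) hw
        simp only [Ψ, LinearMap.pi_apply, LinearMap.sum_apply, LinearMap.comp_apply,
          LinearMap.proj_apply, AddSubmonoidClass.coe_finsetSum, Finset.sum_apply, Pi.zero_apply,
          ZeroMemClass.coe_zero] at h2
        simp only [mulVec, dotProduct] at h2 ⊢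
        rw [Fintype.sum_prod_type_right, Pi.zero_apply]
        exact h2
      funext i
      apply Subtype.ext
      funext a
      exact congrFun h1 (a, i)
    have h1 := LinearMap.finrank_le_finrank_of_injective hΨ
    rw [Module.finrank_pi_fintype, Module.finrank_pi_fintype] at h1
    simp only [Finset.sum_const, Finset.card_univ, smul_eq_mul] at h1
    exact Nat.le_of_mul_le_mul_left h1 Fintype.card_pos
  have hker : LinearMap.ker T.mulVecLin = ⊥ := by
    rw [← Submodule.finrank_eq_zero (R := ℂ)]
    omega
  have hTu : IsUnit T := by
    rw [← mulVec_injective_iff_isUnit]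
    exact LinearMap.ker_eq_bot.mp hker
  set a := Tᴴ * T with ha_def
  have hau : IsUnit a := by
    refine IsUnit.mul ?_ hTu
    rw [← star_eq_conjTranspose]; exact hTu.star
  have has : IsSelfAdjoint a := by
    rw [ha_def, ← star_eq_conjTranspose]; exact .star_mul_self T
  have hpos : ∀ x ∈ spectrum ℝ a, 0 < x := by
    intro x hx
    have h1 : 0 ≤ x := by
      rw [ha_def, ← star_eq_conjTranspose] at hx
      exact spectrum_star_mul_self_nonneg x hx
    refine lt_of_le_of_ne h1 ?_
    rintro rfl
    exact spectrum.zero_notMem ℝ hau hx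
  -- unitary part of the polar decomposition of `T`
  set R := cfc (fun x : ℝ => (Real.sqrt x)⁻¹) a with hR
  have hRs : IsSelfAdjoint R := cfc_predicate _ _
  have hRaR : R * a * R = 1 := by
    have h1 : R * a * R = R * cfc (fun x : ℝ => x) a * R := by rw [cfc_id' ℝ a]
    rw [h1, hR, ← cfc_mul _ _ a (a.continuousOn_spectrum_real _) (a.continuousOn_spectrum_real _),
      ← cfc_mul _ _ a (a.continuousOn_spectrum_real _) (a.continuousOn_spectrum_real _),
      ← cfc_one ℝ a]
    apply cfc_congr
    intro x hx
    have h1 := Real.sqrt_pos.mpr (hpos x hx)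
    have h2 := Real.mul_self_sqrt (hpos x hx).le
    simp only [Pi.one_apply]
    field_simp
    rw [sq, h2]
  refine ⟨T * R, ?_, ?_⟩
  · rw [mem_unitaryGroup_iff', star_mul, hRs.star_eq, ← hRaR, ha_def, star_eq_conjTranspose]
    simp only [mul_assoc]
  · intro d hd
    have h1 : Commute R d.1 := Commute.cfc_real (hHH T hT T hT d hd) _
    rw [mul_assoc, h1.eq, ← mul_assoc, hT d hd, mul_assoc]

end Cancellation

/-! ### Lifting to a continuous path of unitaries -/

section PathLifting

open Matrix

variable {κ : Type*} [Fintype κ] [DecidableEq κ]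

instance Matrix.compactSpace_unitary : CompactSpace (unitary (Matrix κ κ ℂ)) := by
  refine isCompact_iff_compactSpace.mp (?_ : IsCompact (unitary (Matrix κ κ ℂ) : Set (Matrix κ κ ℂ)))
  have : ProperSpace (Matrix κ κ ℂ) := FiniteDimensional.proper ℂ _
  apply Metric.isCompact_of_isClosed_isBounded
  · exact isClosed_unitary
  · rw [isBounded_iff_forall_norm_le]
    refine ⟨1, fun u hu => ?_⟩
    rcases subsingleton_or_nontrivial (Matrix κ κ ℂ) with h | h
    · rw [Subsingleton.elim u 0]; simp
    · rw [CStarRing.norm_of_mem_unitary hu]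

/-- `exp(i arg w) = w`. The jump of `arg` does no harm, since the spectrum is finite. -/
theorem Matrix.expUnitary_argSelfAdjoint (w : unitary (Matrix κ κ ℂ)) :
    selfAdjoint.expUnitary (Unitary.argSelfAdjoint w) = w := by
  apply Subtype.ext
  have hcont : ∀ f : ℂ → ℂ, ContinuousOn f (spectrum ℂ (w : Matrix κ κ ℂ)) := fun f =>
    (Matrix.finite_spectrum (w : Matrix κ κ ℂ)).continuousOn f
  have hs : IsStarNormal (cfc (fun x : ℂ => (x.arg : ℂ)) (w : Matrix κ κ ℂ)) :=
    (IsSelfAdjoint.cfc_arg _).isStarNormal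
  rw [selfAdjoint.expUnitary_coe, Unitary.argSelfAdjoint_coe,
    ← CFC.exp_eq_normedSpace_exp (𝕜 := ℂ), ← cfc_comp_smul Complex.I _ _ (by fun_prop) hs,
    ← cfc_comp' _ _ _ (by fun_prop) (hcont _)]
  conv_rhs => rw [← cfc_id' ℂ (w : Matrix κ κ ℂ)]
  refine cfc_congr fun y hy ↦ ?_
  have h1 : ‖y‖ = 1 := spectrum.norm_eq_one_of_unitary w.2 hy
  have h2 : Complex.I * y.arg = Complex.log y :=
    Complex.ext (by simp [Complex.log_re, h1]) (by simp [Complex.log_im])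
  have h3 : y ≠ 0 := by rintro rfl; simp at h1
  simpa [← Complex.exp_eq_exp_ℂ, h2] using Complex.exp_log h3

/-- The unitary matrices commuting with a given set of matrices form a path connected set: the path
`exp(i s h)` with `h = arg w` joins `1` to `w`. -/
theorem Matrix.exists_path_one_commute (w : unitary (Matrix κ κ ℂ)) :
    ∃ γ : Path (1 : unitary (Matrix κ κ ℂ)) w, ∀ s, ∀ x : Matrix κ κ ℂ,
      Commute (w : Matrix κ κ ℂ) x → Commute (star (w : Matrix κ κ ℂ)) x →
        Commute (γ s : Matrix κ κ ℂ) x := by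
  refine ⟨(selfAdjoint.expUnitaryPathToOne (Unitary.argSelfAdjoint w)).cast rfl
    (Matrix.expUnitary_argSelfAdjoint w).symm, fun s x h1 h2 => ?_⟩
  simp only [Path.cast_coe, selfAdjoint.expUnitaryPathToOne_apply, selfAdjoint.expUnitary_coe]
  apply Commute.exp_left
  apply Commute.smul_left
  simp only [selfAdjoint.val_smul, Unitary.argSelfAdjoint_coe]
  exact (h1.cfc h2 _).smul_left _

variable {J : Type*}

/-- The error with which `c` conjugates the family `D` into the family `Φ`. -/
def conjError (Φ D : J → Matrix κ κ ℂ) (c : unitary (Matrix κ κ ℂ)) (j : J) : ℝ :=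
  ‖Φ j - (c : Matrix κ κ ℂ) * D j * star (c : Matrix κ κ ℂ)‖

theorem continuous_conjError (Φ D : J → Matrix κ κ ℂ) (j : J) :
    Continuous fun c => conjError Φ D c j := by
  unfold conjError; fun_prop

theorem conjError_le (Φ D Φ' D' : J → Matrix κ κ ℂ) (c : unitary (Matrix κ κ ℂ)) (j : J) :
    conjError Φ D c j ≤ conjError Φ' D' c j + (‖Φ j - Φ' j‖ + ‖D' j - D j‖) := by
  unfold conjError
  have h1 : Φ j - (c : Matrix κ κ ℂ) * D j * star (c : Matrix κ κ ℂ) =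
      (Φ' j - (c : Matrix κ κ ℂ) * D' j * star (c : Matrix κ κ ℂ)) +
      ((Φ j - Φ' j) + (c : Matrix κ κ ℂ) * (D' j - D j) * star (c : Matrix κ κ ℂ)) := by
    noncomm_ring
  rw [h1]
  refine (norm_add_le _ _).trans (add_le_add_right ((norm_add_le _ _).trans_eq ?_) _)
  rw [CStarRing.norm_mul_mem_unitary _ (Unitary.star_mem c.2), CStarRing.norm_coe_unitary_mul]

/-- Exact solutions of `c D c⋆ = Φ` lie in one path component of the set of approximate ones. -/
theorem joinedIn_conjError {Φ D : J → Matrix κ κ ℂ} (hΦ : ∀ j, IsSelfAdjoint (Φ j))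
    {c₀ c₁ : unitary (Matrix κ κ ℂ)} (h₀ : ∀ j, conjError Φ D c₀ j = 0)
    (h₁ : ∀ j, conjError Φ D c₁ j = 0) {ε : ℝ} (hε : 0 < ε) :
    JoinedIn {c | ∀ j, conjError Φ D c j < ε} c₀ c₁ := by
  have hc : ∀ c : unitary (Matrix κ κ ℂ), ∀ j, conjError Φ D c j = 0 →
      Φ j = (c : Matrix κ κ ℂ) * D j * star (c : Matrix κ κ ℂ) := by
    intro c j h
    exact sub_eq_zero.mp (norm_eq_zero.mp h)
  obtain ⟨γ, hγ⟩ := Matrix.exists_path_one_commute (c₁ * star c₀)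
  have hcomm : ∀ j, Commute ((c₁ * star c₀ : unitary (Matrix κ κ ℂ)) : Matrix κ κ ℂ) (Φ j) := by
    intro j
    have e0 : star (c₀ : Matrix κ κ ℂ) * c₀ = 1 := Unitary.coe_star_mul_self c₀
    have e1 : star (c₁ : Matrix κ κ ℂ) * c₁ = 1 := Unitary.coe_star_mul_self c₁
    rw [commute_iff_eq]
    simp only [Submonoid.coe_mul, Unitary.coe_star]
    calc (c₁ : Matrix κ κ ℂ) * star (c₀ : Matrix κ κ ℂ) * Φ j
        = c₁ * star (c₀ : Matrix κ κ ℂ) * (c₀ * D j * star (c₀ : Matrix κ κ ℂ)) := by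
          rw [← hc c₀ j (h₀ j)]
      _ = c₁ * (star (c₀ : Matrix κ κ ℂ) * c₀) * D j * star (c₀ : Matrix κ κ ℂ) := by noncomm_ring
      _ = c₁ * D j * (star (c₁ : Matrix κ κ ℂ) * c₁) * star (c₀ : Matrix κ κ ℂ) := by
          rw [e0, e1]; noncomm_ring
      _ = (c₁ * D j * star (c₁ : Matrix κ κ ℂ)) * (c₁ * star (c₀ : Matrix κ κ ℂ)) := by noncomm_ring
      _ = _ := by rw [← hc c₁ j (h₁ j)]
  have hcomm' : ∀ j, Commute (star ((c₁ * star c₀ : unitary (Matrix κ κ ℂ)) : Matrix κ κ ℂ))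
      (Φ j) := by
    intro j
    have := (hcomm j).star_star
    rwa [(hΦ j).star_eq] at this
  refine ⟨(γ.map (f := fun x => x * c₀) (by fun_prop)).cast (by simp) (by simp [mul_assoc]), ?_⟩
  intro s j
  have h2 := hγ s (Φ j) (hcomm j) (hcomm' j)
  have h3 : conjError Φ D (γ s * c₀) j = 0 := by
    unfold conjError
    rw [norm_eq_zero, sub_eq_zero]
    have e : (γ s : Matrix κ κ ℂ) * star (γ s : Matrix κ κ ℂ) = 1 := Unitary.coe_mul_star_self _
    simp only [Submonoid.coe_mul, star_mul]
    calc Φ j = Φ j * ((γ s : Matrix κ κ ℂ) * star (γ s : Matrix κ κ ℂ)) := by rw [e, mul_one]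
      _ = γ s * (c₀ * D j * star (c₀ : Matrix κ κ ℂ)) * star (γ s : Matrix κ κ ℂ) := by
        rw [← hc c₀ j (h₀ j), ← mul_assoc, h2.eq]
      _ = _ := by noncomm_ring
  simpa using h3 ▸ hε

/-- Near `t₀` the values `u(t)` lie in one path component of a set of approximate solutions which serves
for all `t` near `t₀`. -/
theorem exists_open_joinedIn_conjError [Fintype J] {Φ D : J → I → Matrix κ κ ℂ}
    (hΦc : ∀ j, Continuous (Φ j)) (hDc : ∀ j, Continuous (D j))
    (hΦ : ∀ j t, IsSelfAdjoint (Φ j t)) {u : I → unitary (Matrix κ κ ℂ)}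
    (hu : ∀ t j, conjError (Φ · t) (D · t) (u t) j = 0) {ε : ℝ} (hε : 0 < ε) (t₀ : I) :
    ∃ N : Set I, IsOpen N ∧ t₀ ∈ N ∧ ∃ O : Set (unitary (Matrix κ κ ℂ)),
      (∀ s ∈ N, ∀ t ∈ N, JoinedIn O (u s) (u t)) ∧
      ∀ t ∈ N, ∀ c ∈ O, ∀ j, conjError (Φ · t) (D · t) c j < ε := by
  set O : Set (unitary (Matrix κ κ ℂ)) := {c | ∀ j, conjError (Φ · t₀) (D · t₀) c j < ε / 2} with hO
  have hOo : IsOpen O := by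
    have : O = ⋂ j, {c | conjError (Φ · t₀) (D · t₀) c j < ε / 2} := by ext; simp [hO]
    rw [this]
    exact isOpen_iInter_of_finite fun j =>
      isOpen_lt (continuous_conjError _ _ j) continuous_const
  set V := pathComponentIn O (u t₀) with hV
  have hVo : IsOpen V := hOo.pathComponentIn _
  have hmem : ∀ c, (∀ j, conjError (Φ · t₀) (D · t₀) c j = 0) → c ∈ V := fun c hc =>
    joinedIn_conjError (fun j => hΦ j t₀) (hu t₀) hc (half_pos hε)
  -- by compactness, unitaries of small total error lie in `V`
  obtain ⟨η, hη, hηV⟩ : ∃ η > 0, ∀ c, ∑ j, conjError (Φ · t₀) (D · t₀) c j < η → c ∈ V := by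
    have hcont : Continuous fun c => ∑ j, conjError (Φ · t₀) (D · t₀) c j :=
      continuous_finsetSum _ fun j _ => continuous_conjError _ _ j
    rcases (Vᶜ).eq_empty_or_nonempty with h | h
    · exact ⟨1, one_pos, fun c _ => by simpa using Set.compl_empty_iff.mp h ▸ Set.mem_univ c⟩
    · obtain ⟨c, hc, hmin⟩ := hVo.isClosed_compl.isCompact.exists_isMinOn h hcont.continuousOn
      refine ⟨∑ j, conjError (Φ · t₀) (D · t₀) c j, lt_of_le_of_ne (Finset.sum_nonneg
        (f := fun j => conjError (Φ · t₀) (D · t₀) c j) fun j _ => norm_nonneg _) ?_, fun d hd => ?_⟩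
      · intro h0
        refine hc (hmem c fun j => ?_)
        exact (Finset.sum_eq_zero_iff_of_nonneg
          (f := fun j => conjError (Φ · t₀) (D · t₀) c j) (fun j _ => norm_nonneg _)).mp h0.symm j
          (Finset.mem_univ j)
      · by_contra hdV
        exact absurd (hmin hdV) (not_le.mpr hd)
  set m : I → ℝ := fun t => ∑ j, (‖Φ j t - Φ j t₀‖ + ‖D j t₀ - D j t‖) with hm
  have hmc : Continuous m := by
    simp only [hm]; fun_prop
  have hm0 : m t₀ = 0 := by simp [hm]
  have hmj : ∀ t j, ‖Φ j t - Φ j t₀‖ + ‖D j t₀ - D j t‖ ≤ m t := fun t j =>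
    Finset.single_le_sum (f := fun j => ‖Φ j t - Φ j t₀‖ + ‖D j t₀ - D j t‖)
      (fun j _ => by positivity) (Finset.mem_univ j)
  refine ⟨{t | m t < min η (ε / 2)}, isOpen_lt hmc continuous_const, ?_, O, ?_, ?_⟩
  · simp only [Set.mem_ofPred_eq, hm0]
    exact lt_min hη (half_pos hε)
  · have huV : ∀ s ∈ {t | m t < min η (ε / 2)}, u s ∈ V := by
      intro s hs
      apply hηV
      refine lt_of_le_of_lt ?_ (lt_of_lt_of_le hs (min_le_left _ _))
      refine Finset.sum_le_sum fun j _ => ?_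
      have := conjError_le (Φ · t₀) (D · t₀) (Φ · s) (D · s) (u s) j
      rw [hu s j, zero_add, norm_sub_rev, norm_sub_rev (D j s)] at this
      exact this
    intro s hs t ht
    exact (huV s hs).symm.trans (huV t ht)
  · intro t ht c hc j
    have h1 := conjError_le (Φ · t) (D · t) (Φ · t₀) (D · t₀) c j
    have h2 := hc j
    have h3 : m t < ε / 2 := lt_of_lt_of_le (show m t < min η (ε / 2) from ht) (min_le_right _ _)
    have h4 := hmj t j
    linarith

/-- If `Φ(t) = u(t) D(t) u(t)⋆` for finitely many continuous paths of self-adjoint matrices and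
unitaries `u(t)` with no continuity, then `u` can be replaced by a continuous path of unitaries with
the same endpoints, at the cost of an arbitrarily small error. -/
theorem exists_continuous_conjError_lt [Fintype J] {Φ D : J → I → Matrix κ κ ℂ}
    (hΦc : ∀ j, Continuous (Φ j)) (hDc : ∀ j, Continuous (D j))
    (hΦ : ∀ j t, IsSelfAdjoint (Φ j t)) {u : I → unitary (Matrix κ κ ℂ)}
    (hu : ∀ t j, conjError (Φ · t) (D · t) (u t) j = 0) {ε : ℝ} (hε : 0 < ε) :
    ∃ v : C(I, unitary (Matrix κ κ ℂ)), v 0 = u 0 ∧ v 1 = u 1 ∧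
      ∀ t j, conjError (Φ · t) (D · t) (v t) j < ε := by
  choose N hNo hN O hO hOε using exists_open_joinedIn_conjError hΦc hDc hΦ hu hε
  obtain ⟨t, ht0, htm, ⟨n₀, hn₀⟩, ht⟩ := exists_monotone_Icc_subset_open_cover_unitInterval hNo
    (fun s _ => Set.mem_iUnion.mpr ⟨s, hN s⟩)
  -- one step of the partition
  have hstep : ∀ n, ∃ γ : I → unitary (Matrix κ κ ℂ), ContinuousOn γ (Set.Icc (t n) (t (n + 1))) ∧
      γ (t n) = u (t n) ∧ γ (t (n + 1)) = u (t (n + 1)) ∧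
      ∀ s ∈ Set.Icc (t n) (t (n + 1)), ∀ j, conjError (Φ · s) (D · s) (γ s) j < ε := by
    intro n
    obtain ⟨i, hi⟩ := ht n
    have hle := htm n.le_succ
    have hl := hi (Set.left_mem_Icc.mpr hle)
    have hr := hi (Set.right_mem_Icc.mpr hle)
    rcases hle.eq_or_lt with heq | hlt
    · refine ⟨fun _ => u (t n), continuousOn_const, rfl, by rw [heq], fun s hs j => ?_⟩
      exact hOε i s (hi hs) _ (hO i _ hl _ hl).source_mem j
    · obtain ⟨p, hp⟩ := hO i _ hl _ hr
      have hpos : (0 : ℝ) < (t (n + 1) : ℝ) - t n := sub_pos.mpr hlt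
      refine ⟨fun s => p.extend (((s : ℝ) - t n) / ((t (n + 1) : ℝ) - t n)), ?_, ?_, ?_, ?_⟩
      · exact Continuous.continuousOn (p.continuous_extend.comp (by fun_prop))
      · simp
      · simp [div_self hpos.ne']
      · intro s hs j
        refine hOε i s (hi hs) _ ?_ j
        simp only
        rw [Path.extend_apply _ ⟨div_nonneg (sub_nonneg.mpr (show (t n : ℝ) ≤ s from hs.1)) hpos.le,
          (div_le_one hpos).mpr (sub_le_sub_right (show (s : ℝ) ≤ t (n + 1) from hs.2) _)⟩]
        exact hp _
  have hind : ∀ n, ∃ γ : I → unitary (Matrix κ κ ℂ), ContinuousOn γ (Set.Icc 0 (t n)) ∧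
      γ 0 = u 0 ∧ γ (t n) = u (t n) ∧
      ∀ s ∈ Set.Icc 0 (t n), ∀ j, conjError (Φ · s) (D · s) (γ s) j < ε := by
    intro n
    induction n with
    | zero =>
      refine ⟨fun _ => u 0, continuousOn_const, rfl, by rw [ht0], fun s hs j => ?_⟩
      rw [ht0, Set.Icc_self, Set.mem_singleton_iff] at hs
      subst hs
      rw [hu 0 j]
      exact hε
    | succ n ih =>
      obtain ⟨γ₁, hc₁, h₁0, h₁n, h₁⟩ := ih
      obtain ⟨γ₂, hc₂, h₂n, h₂n', h₂⟩ := hstep n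
      have hle := htm n.le_succ
      have heq₁ : ∀ s ∈ Set.Icc 0 (t n), (if s ≤ t n then γ₁ s else γ₂ s) = γ₁ s :=
        fun s hs => if_pos hs.2
      have heq₂ : ∀ s ∈ Set.Icc (t n) (t (n + 1)), (if s ≤ t n then γ₁ s else γ₂ s) = γ₂ s := by
        intro s hs
        by_cases h : s ≤ t n
        · have h3 := le_antisymm h hs.1
          subst h3
          rw [if_pos h, h₁n, h₂n]
        · exact if_neg h
      refine ⟨fun s => if s ≤ t n then γ₁ s else γ₂ s, ?_, ?_, ?_, ?_⟩
      · rw [← Set.Icc_union_Icc_eq_Icc unitInterval.nonneg' hle]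
        exact ContinuousOn.union_of_isClosed (hc₁.congr heq₁) (hc₂.congr heq₂) isClosed_Icc
          isClosed_Icc
      · exact (heq₁ 0 ⟨le_rfl, unitInterval.nonneg'⟩).trans h₁0
      · exact (heq₂ _ ⟨hle, le_rfl⟩).trans h₂n'
      · intro s hs j
        simp only
        rcases le_total s (t n) with h | h
        · rw [heq₁ s ⟨hs.1, h⟩]; exact h₁ s ⟨hs.1, h⟩ j
        · rw [heq₂ s ⟨h, hs.2⟩]; exact h₂ s ⟨h, hs.2⟩ j
  obtain ⟨γ, hγc, hγ0, hγ1, hγ⟩ := hind n₀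
  rw [hn₀ n₀ le_rfl] at hγc hγ1 hγ
  have huniv : Set.Icc (0 : I) 1 = Set.univ := by
    ext s; simp [unitInterval.le_one']
  rw [huniv] at hγc hγ
  exact ⟨⟨γ, continuousOn_univ.mp hγc⟩, hγ0, hγ1, fun s j => hγ s (Set.mem_univ s) j⟩

end PathLifting

/-! ### Relabelling block diagonal matrices -/

section BlockCounting

open Matrix

/-- `diag(a, …, a, z, …, z)`, with `ν` blocks `a` followed by `n - ν` scalar blocks `z`. -/
def cutDiag (ν n k : ℕ) (a : Matrix (Fin k) (Fin k) ℂ) (z : ℂ) :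
    Matrix (Fin k × Fin n) (Fin k × Fin n) ℂ :=
  blockDiagonal fun j : Fin n => if (j : ℕ) < ν then a else diagonal fun _ => z

/-- `diag(a, …, a) ⊕ diag(z, …, z) ⊕ ⨁_j H_j`, with copies of `a` indexed by `α`, copies of the
scalar `z` indexed by `γ`, and `j` ranging over `β`. -/
def sumDiag {K α γ ι β : Type*} [DecidableEq α] [DecidableEq γ] [DecidableEq β]
    (a : Matrix K K ℂ) (z : ℂ) (H : β → Matrix ι ι ℂ) :
    Matrix (K × α ⊕ γ ⊕ ι × β) (K × α ⊕ γ ⊕ ι × β) ℂ :=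
  fromBlocks (blockDiagonal fun _ : α => a) 0 0
    (fromBlocks (diagonal fun _ : γ => z) 0 0 (blockDiagonal H))

theorem sumDiag_submatrix {K α γ α' γ' ι β : Type*} [DecidableEq α] [DecidableEq γ] [DecidableEq α']
    [DecidableEq γ'] [DecidableEq β] (a : Matrix K K ℂ) (z : ℂ) (H : β → Matrix ι ι ℂ)
    (eα : α ≃ α') (eγ : γ ≃ γ') :
    (sumDiag a z H).submatrix
        (Equiv.sumCongr ((Equiv.refl K).prodCongr eα) (eγ.sumCongr (Equiv.refl (ι × β))))
        (Equiv.sumCongr ((Equiv.refl K).prodCongr eα) (eγ.sumCongr (Equiv.refl (ι × β)))) =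
      sumDiag a z H := by
  ext x y
  rcases x with ⟨r, c⟩ | c | ⟨i, b⟩ <;> rcases y with ⟨r', c'⟩ | c' | ⟨i', b'⟩ <;>
    simp [sumDiag, blockDiagonal_apply, diagonal_apply]

/-- Collecting the blocks `a`, the scalars `z` and the blocks `H_j` of a block diagonal matrix whose
blocks are `diag(a, …, a)`, `H_j` (`ν` times) or `diag(a, …, a, z)`. -/
theorem blockDiagonal_submatrix_eq_sumDiag {n k l R₀ R₁ m ν : ℕ}
    (e : Fin R₀ ⊕ (Fin m × Fin ν) ⊕ Fin R₁ ≃ Fin l) :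
    ∃ g : (Fin k × (Fin n × Fin R₀ ⊕ {j : Fin n // (j : ℕ) < n - 1} × Fin R₁) ⊕
        (Fin k × {j : Fin n // ¬ (j : ℕ) < n - 1} × Fin R₁) ⊕ (Fin k × Fin n) × (Fin m × Fin ν)) ≃
        (Fin k × Fin n) × Fin l,
      ∀ a z (H : Fin m → Matrix (Fin k × Fin n) (Fin k × Fin n) ℂ)
        (G : Fin l → Matrix (Fin k × Fin n) (Fin k × Fin n) ℂ),
        (∀ x, G (e (.inl x)) = cutDiag n n k a z) →
        (∀ x, G (e (.inr (.inr x))) = cutDiag (n - 1) n k a z) →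
        (∀ x, G (e (.inr (.inl x))) = H x.1) →
        (blockDiagonal G).submatrix g g = sumDiag a z fun x : Fin m × Fin ν => H x.1 := by
  let g : (Fin k × (Fin n × Fin R₀ ⊕ {j : Fin n // (j : ℕ) < n - 1} × Fin R₁) ⊕
        (Fin k × {j : Fin n // ¬ (j : ℕ) < n - 1} × Fin R₁) ⊕ (Fin k × Fin n) × (Fin m × Fin ν)) →
        (Fin k × Fin n) × Fin l := fun x =>
    match x with
    | .inl (r, .inl (j, x)) => ((r, j), e (.inl x))
    | .inl (r, .inr (j, x)) => ((r, j), e (.inr (.inr x)))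
    | .inr (.inl (r, j, x)) => ((r, j), e (.inr (.inr x)))
    | .inr (.inr (i, x)) => (i, e (.inr (.inl x)))
  have hg : Function.Bijective g := by
    constructor
    · intro x y hxy
      rcases x with ⟨r, ⟨j, x⟩ | ⟨⟨j, hj⟩, x⟩⟩ | ⟨r, ⟨j, hj⟩, x⟩ | ⟨i, x⟩ <;>
      rcases y with ⟨r', ⟨j', x'⟩ | ⟨⟨j', hj'⟩, x'⟩⟩ | ⟨r', ⟨j', hj'⟩, x'⟩ | ⟨i', x'⟩ <;>
      simp only [g, Prod.mk.injEq, e.apply_eq_iff_eq, Sum.inl.injEq, Sum.inr.injEq, reduceCtorEq,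
        and_false, Subtype.mk.injEq] at hxy ⊢ <;>
      first
        | tauto
        | (exfalso; obtain ⟨⟨rfl, rfl⟩, -⟩ := hxy; contradiction)
    · rintro ⟨⟨r, j⟩, i⟩
      obtain ⟨x, rfl⟩ := e.surjective i
      rcases x with x | x | x
      · exact ⟨.inl (r, .inl (j, x)), rfl⟩
      · exact ⟨.inr (.inr ((r, j), x)), rfl⟩
      · by_cases hj : (j : ℕ) < n - 1
        · exact ⟨.inl (r, .inr (⟨j, hj⟩, x)), rfl⟩
        · exact ⟨.inr (.inl (r, ⟨j, hj⟩, x)), rfl⟩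
  refine ⟨Equiv.ofBijective g hg, fun a z H G h₀ h₁ h₂ => ?_⟩
  ext x y
  rcases x with ⟨r, ⟨j, x⟩ | ⟨⟨j, hj⟩, x⟩⟩ | ⟨r, ⟨j, hj⟩, x⟩ | ⟨i, x⟩ <;>
  rcases y with ⟨r', ⟨j', x'⟩ | ⟨⟨j', hj'⟩, x'⟩⟩ | ⟨r', ⟨j', hj'⟩, x'⟩ | ⟨i', x'⟩ <;>
  simp only [submatrix_apply, Equiv.ofBijective_apply, g, blockDiagonal_apply, sumDiag,
    fromBlocks_apply₁₁, fromBlocks_apply₁₂, fromBlocks_apply₂₁, fromBlocks_apply₂₂, Matrix.zero_apply,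
    h₀, h₁, h₂, e.apply_eq_iff_eq, Sum.inl.injEq, Sum.inr.injEq, reduceCtorEq, if_false, cutDiag,
    Fin.is_lt, if_true, Prod.mk.injEq, diagonal_apply, Subtype.mk.injEq]
  all_goals grind [diagonal_apply]

/-- Collecting the blocks `a`, the scalars `z` and the blocks `H_j` of `ν` copies of
`diag(a, …, a) ⊕ diag(z, …, z) ⊕ ⨁ H_j` followed by scalars `z`. -/
theorem cutDiag_submatrix_eq_sumDiag {ι : Type*} {p q m k k' ν n' : ℕ} (hν : ν ≤ n')
    (e : Fin k × Fin p ⊕ Fin q ⊕ ι × Fin m ≃ Fin k') :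
    ∃ g : (Fin k × (Fin p × Fin ν) ⊕ (Fin q × Fin ν ⊕ Fin k' × {j : Fin n' // ¬ (j : ℕ) < ν}) ⊕
        ι × (Fin m × Fin ν)) ≃ Fin k' × Fin n',
      ∀ a z (H : Fin m → Matrix ι ι ℂ),
        (cutDiag ν n' k' (reindex e e (sumDiag a z H)) z).submatrix g g =
          sumDiag a z fun x : Fin m × Fin ν => H x.1 := by
  let g : (Fin k × (Fin p × Fin ν) ⊕ (Fin q × Fin ν ⊕ Fin k' × {j : Fin n' // ¬ (j : ℕ) < ν}) ⊕
        ι × (Fin m × Fin ν)) → Fin k' × Fin n' := fun x =>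
    match x with
    | .inl (r, c, x) => (e (.inl (r, c)), x.castLE hν)
    | .inr (.inl (.inl (c, x))) => (e (.inr (.inl c)), x.castLE hν)
    | .inr (.inl (.inr (r, j))) => (r, j.1)
    | .inr (.inr (i, c, x)) => (e (.inr (.inr (i, c))), x.castLE hν)
  have hg : Function.Bijective g := by
    constructor
    · intro x y hxy
      rcases x with ⟨r, c, x⟩ | (⟨c, x⟩ | ⟨r, ⟨j, hj⟩⟩) | ⟨i, c, x⟩ <;>
      rcases y with ⟨r', c', x'⟩ | (⟨c', x'⟩ | ⟨r', ⟨j', hj'⟩⟩) | ⟨i', c', x'⟩ <;>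
      simp only [g, Prod.mk.injEq, e.apply_eq_iff_eq, Sum.inl.injEq, Sum.inr.injEq, reduceCtorEq,
        false_and, Subtype.mk.injEq, Fin.ext_iff, Fin.val_castLE] at hxy ⊢ <;>
      first
        | tauto
        | omega
    · rintro ⟨r, j⟩
      by_cases hj : (j : ℕ) < ν
      · obtain ⟨x, rfl⟩ := e.surjective r
        rcases x with ⟨r, c⟩ | c | ⟨i, c⟩
        · exact ⟨.inl (r, c, ⟨j, hj⟩), rfl⟩
        · exact ⟨.inr (.inl (.inl (c, ⟨j, hj⟩))), rfl⟩
        · exact ⟨.inr (.inr (i, c, ⟨j, hj⟩)), rfl⟩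
      · exact ⟨.inr (.inl (.inr (r, ⟨j, hj⟩))), rfl⟩
  refine ⟨Equiv.ofBijective g hg, fun a z H => ?_⟩
  ext x y
  rcases x with ⟨r, c, x⟩ | (⟨c, x⟩ | ⟨r, ⟨j, hj⟩⟩) | ⟨i, c, x⟩ <;>
  rcases y with ⟨r', c', x'⟩ | (⟨c', x'⟩ | ⟨r', ⟨j', hj'⟩⟩) | ⟨i', c', x'⟩ <;>
  simp only [submatrix_apply, Equiv.ofBijective_apply, g, blockDiagonal_apply, sumDiag,
    fromBlocks_apply₁₁, fromBlocks_apply₁₂, fromBlocks_apply₂₁, fromBlocks_apply₂₂, Matrix.zero_apply,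
    reindex_apply, e.symm_apply_apply, Sum.inl.injEq, Sum.inr.injEq, reduceCtorEq, if_false, cutDiag,
    Fin.is_lt, if_true, Prod.mk.injEq, diagonal_apply, Subtype.mk.injEq, Fin.val_castLE]
  all_goals grind [diagonal_apply]

theorem Fin.card_subtype_val_lt {n ν : ℕ} (h : ν ≤ n) :
    Fintype.card {j : Fin n // (j : ℕ) < ν} = ν := by
  rw [Fintype.card_subtype, Fin.card_filter_val_lt, min_eq_right h]

theorem Fin.card_subtype_not_val_lt {n ν : ℕ} (h : ν ≤ n) :
    Fintype.card {j : Fin n // ¬ (j : ℕ) < ν} = n - ν := by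
  rw [Fintype.card_subtype_compl, Fin.card_subtype_val_lt h, Fintype.card_fin]

/-- A block diagonal matrix with `R₀` blocks `diag(a, …, a)`, then `ν` copies of each of
`H_0, …, H_{m-1}`, then `R₁` blocks `diag(a, …, a, z)`, is a relabelling of `ν` copies of
`diag(a, …, a) ⊕ diag(z, …, z) ⊕ ⨁ H_j` followed by scalars `z`, as soon as the multiplicities
agree. The relabelling `P` does not depend on `a`, `z` and `H`. -/
theorem exists_block_equiv {n k n' k' l R₀ R₁ m ν p q : ℕ} (hν : ν ≤ n')
    (hl : R₀ + m * ν + R₁ = l) (hA : n * R₀ + (n - 1) * R₁ = p * ν) (hn : 0 < n)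
    (hB : k * R₁ = q * ν + k' * (n' - ν))
    (e : Fin k × Fin p ⊕ Fin q ⊕ (Fin k × Fin n) × Fin m ≃ Fin k') :
    ∃ P : (Fin k × Fin n) × Fin l ≃ Fin k' × Fin n',
      ∀ a z (H : Fin m → Matrix (Fin k × Fin n) (Fin k × Fin n) ℂ)
        (G : Fin l → Matrix (Fin k × Fin n) (Fin k × Fin n) ℂ),
        (∀ i : Fin l, (i : ℕ) < R₀ → G i = cutDiag n n k a z) →
        (∀ i : Fin l, R₀ + m * ν ≤ (i : ℕ) → G i = cutDiag (n - 1) n k a z) →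
        (∀ (i : Fin l) (j : Fin m) (r : Fin ν), (i : ℕ) = R₀ + (r + ν * j) → G i = H j) →
        reindex P P (blockDiagonal G) = cutDiag ν n' k' (reindex e e (sumDiag a z H)) z := by
  let idx : Fin R₀ ⊕ (Fin m × Fin ν) ⊕ Fin R₁ ≃ Fin l :=
    ((Equiv.refl _).sumCongr ((finProdFinEquiv.sumCongr (Equiv.refl _)).trans finSumFinEquiv)).trans
      (finSumFinEquiv.trans (finCongr (by omega)))
  obtain ⟨g₁, hg₁⟩ := blockDiagonal_submatrix_eq_sumDiag (n := n) (k := k) idx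
  obtain ⟨g₂, hg₂⟩ := cutDiag_submatrix_eq_sumDiag (k := k) hν e
  have eα : (Fin n × Fin R₀ ⊕ {j : Fin n // (j : ℕ) < n - 1} × Fin R₁) ≃ Fin p × Fin ν :=
    Fintype.equivOfCardEq (by
      simp only [Fintype.card_sum, Fintype.card_prod, Fintype.card_fin,
        Fin.card_subtype_val_lt (Nat.sub_le n 1)]
      exact hA)
  have eγ : Fin k × {j : Fin n // ¬ (j : ℕ) < n - 1} × Fin R₁ ≃
      Fin q × Fin ν ⊕ Fin k' × {j : Fin n' // ¬ (j : ℕ) < ν} :=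
    Fintype.equivOfCardEq (by
      simp only [Fintype.card_sum, Fintype.card_prod, Fintype.card_fin,
        Fin.card_subtype_not_val_lt (Nat.sub_le n 1), Fin.card_subtype_not_val_lt hν]
      rw [← hB, Nat.sub_sub_self hn, Nat.succ_eq_add_one, zero_add, one_mul])
  set c := Equiv.sumCongr ((Equiv.refl (Fin k)).prodCongr eα)
    (eγ.sumCongr (Equiv.refl ((Fin k × Fin n) × (Fin m × Fin ν)))) with hc
  refine ⟨g₁.symm.trans (c.trans g₂), fun a z H G h₀ h₁ h₂ => ?_⟩
  have e₁ := hg₁ a z H G ?_ ?_ ?_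
  · have e₂ := hg₂ a z H
    have e₃ := sumDiag_submatrix a z (fun x : Fin m × Fin ν => H x.1) eα eγ
    rw [← hc, ← e₂, ← e₁, submatrix_submatrix] at e₃
    ext x y
    obtain ⟨x, rfl⟩ := (c.trans g₂).surjective x
    obtain ⟨y, rfl⟩ := (c.trans g₂).surjective y
    have := congrFun (congrFun e₃ x) y
    simpa using this.symm
  · intro x
    exact h₀ _ (by simp [idx])
  · intro x
    refine h₁ _ ?_
    simp [idx]
  · rintro ⟨j, r⟩
    refine h₂ _ j r ?_
    simp [idx]

/-! ### Counting functions of sorted families -/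

theorem Monotone.le_iff_lt_card {l : ℕ} {τ : Fin l → I} (hτ : Monotone τ) (i : Fin l) (y : I) :
    τ i ≤ y ↔ (i : ℕ) < (Finset.univ.filter fun j => τ j ≤ y).card := by
  constructor
  · intro h
    have : Finset.Iic i ⊆ Finset.univ.filter fun j => τ j ≤ y := by
      intro j hj
      rw [Finset.mem_filter]
      exact ⟨Finset.mem_univ j, (hτ (Finset.mem_Iic.mp hj)).trans h⟩
    have := Finset.card_le_card this
    rw [Fin.card_Iic] at this
    omega
  · intro h
    by_contra hcon
    have : (Finset.univ.filter fun j => τ j ≤ y) ⊆ Finset.Iio i := by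
      intro j hj
      rw [Finset.mem_filter] at hj
      rw [Finset.mem_Iio]
      by_contra hij
      exact hcon ((hτ (not_lt.mp hij)).trans hj.2)
    have := Finset.card_le_card this
    rw [Fin.card_Iio] at this
    omega

/-- The generalized inverse of a counting function `T : [0,1) → ℕ`: the point of index `j` (from `0`) of
a sorted family of which `T y` members are at most `y`, or `1` if there is no such point below
`1`. -/
def countInv (T : I → ℕ) (j : ℕ) : I := sInf {y | y = 1 ∨ j < T y}

theorem eq_countInv_of_le_iff {T : I → ℕ} {j : ℕ} {x : I} (h : ∀ y < 1, x ≤ y ↔ j < T y) :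
    x = countInv T j := by
  have : {y : I | y = 1 ∨ j < T y} = Set.Ici x := by
    ext y
    simp only [Set.mem_ofPred_eq, Set.mem_Ici]
    rcases eq_or_ne y 1 with rfl | hy
    · simp [unitInterval.le_one']
    · rw [h y (lt_of_le_of_ne unitInterval.le_one' hy)]
      simp [hy]
  rw [countInv, this, csInf_Ici]

section SortedFamily

variable {l ν s : ℕ} {τ : Fin l → I} {T : I → ℕ}

/-- The members of `τ` below `1` are counted by `ν T`, with the first `s` points removed. Nothing is
required at `y = 1`, where all members are counted. -/
def IsCount (τ : Fin l → I) (s ν : ℕ) (T : I → ℕ) : Prop :=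
  ∀ y < 1, (Finset.univ.filter fun i => τ i ≤ y).card + s = ν * T y

theorem IsCount.le_iff (hT : IsCount τ s ν T) (hτ : Monotone τ) (i : Fin l) {y : I} (hy : y < 1) :
    τ i ≤ y ↔ (i : ℕ) + s < ν * T y := by
  rw [hτ.le_iff_lt_card, ← hT y hy]
  omega

theorem IsCount.eq_zero (hT : IsCount τ s ν T) (hτ : Monotone τ) {T₀ : ℕ} (h₀ : T₀ ≤ T 0)
    {i : Fin l} (hi : (i : ℕ) + s < ν * T₀) : τ i = 0 := by
  have h := (hT.le_iff hτ i (y := 0) zero_lt_one).mpr (hi.trans_le (Nat.mul_le_mul_left ν h₀))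
  exact le_antisymm h unitInterval.nonneg'

theorem IsCount.eq_one (hT : IsCount τ s ν T) (hτ : Monotone τ) {T₁ : ℕ} (h₁ : ∀ y < 1, T y ≤ T₁)
    {i : Fin l} (hi : ν * T₁ ≤ (i : ℕ) + s) : τ i = 1 := by
  by_contra hne
  have hlt : τ i < 1 := lt_of_le_of_ne unitInterval.le_one' hne
  have h := (hT.le_iff hτ i hlt).mp le_rfl
  have := Nat.mul_le_mul_left ν (h₁ _ hlt)
  omega

theorem IsCount.eq_countInv (hT : IsCount τ s ν T) (hτ : Monotone τ) {i : Fin l} {j r : ℕ}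
    (hr : r < ν) (hi : (i : ℕ) + s = r + ν * j) : τ i = countInv T j := by
  refine eq_countInv_of_le_iff fun y hy => ?_
  rw [hT.le_iff hτ i hy, hi]
  constructor
  · intro h
    by_contra hcon
    have := Nat.mul_le_mul_left ν (not_lt.mp hcon)
    omega
  · intro h
    have h1 := Nat.mul_le_mul_left ν (Nat.succ_le_of_lt h)
    rw [Nat.mul_succ] at h1
    omega

theorem IsCount.exists_max (hT : IsCount τ s ν T) (hν : 0 < ν) :
    ∃ y₁ < 1, ∀ y < 1, T y ≤ T y₁ := by
  have hbdd : BddAbove (T '' Set.Iio 1) := by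
    refine ⟨l + s, ?_⟩
    rintro _ ⟨y, hy, rfl⟩
    have h1 := hT y hy
    have h2 := Finset.card_filter_le (Finset.univ : Finset (Fin l)) fun i => τ i ≤ y
    rw [Finset.card_univ, Fintype.card_fin] at h2
    have h3 := Nat.le_mul_of_pos_left (T y) hν
    omega
  obtain ⟨y₁, hy₁, h⟩ := Nat.sSup_mem (s := T '' Set.Iio 1) ⟨_, 0, Set.mem_Iio.mpr zero_lt_one, rfl⟩ hbdd
  exact ⟨y₁, hy₁, fun y hy => h ▸ le_csSup hbdd ⟨y, hy, rfl⟩⟩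

theorem IsCount.le_mul (hT : IsCount τ s ν T) {y : I} (hy : y < 1) : s ≤ ν * T y := by
  have := hT y hy
  omega

theorem IsCount.mul_le (hT : IsCount τ s ν T) {y : I} (hy : y < 1) : ν * T y ≤ l + s := by
  have h1 := hT y hy
  have h2 := Finset.card_filter_le (Finset.univ : Finset (Fin l)) fun i => τ i ≤ y
  rw [Finset.card_univ, Fintype.card_fin] at h2
  omega

end SortedFamily

/-! ### Multiplicities and relabellings at the endpoints -/

/-- Multiplicities at the two endpoints: with `s = (n - 1) l`, the endpoint `0` carries `n' T₀ - s`
zeros and `l + s - n' T₁` ones, and the endpoint `1` carries `(n' - 1) T₀ - s` zeros and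
`l + s - (n' - 1) T₁` ones. Both fit the same `p = n T₀ - (n - 1) T₁` and `q = k' - k T₁`. -/
theorem exists_multiplicities {n k n' k' l T₀ m : ℕ} (hn : 0 < n) (hn' : 0 < n')
    (hsize : n * k * l = n' * k') (h0 : (n - 1) * l ≤ n' * T₀)
    (h1 : n' * (T₀ + m) ≤ l + (n - 1) * l) :
    ∃ p q, k * p + (q + k * n * m) = k' ∧
      ∀ ν ≤ n', (n - 1) * l ≤ ν * T₀ → ν * (T₀ + m) ≤ l + (n - 1) * l → (ν = n' ∨ ν + 1 = n') →
        (ν * T₀ - (n - 1) * l) + m * ν + (l + (n - 1) * l - ν * (T₀ + m)) = l ∧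
        n * (ν * T₀ - (n - 1) * l) + (n - 1) * (l + (n - 1) * l - ν * (T₀ + m)) = p * ν ∧
        k * (l + (n - 1) * l - ν * (T₀ + m)) = q * ν + k' * (n' - ν) := by
  obtain ⟨n, rfl⟩ := Nat.exists_eq_add_of_le' hn
  simp only [Nat.add_sub_cancel] at *
  obtain ⟨x, hx⟩ := Nat.exists_eq_add_of_le h0
  obtain ⟨y, hy⟩ := Nat.exists_eq_add_of_le h1
  have hp0 : n * (T₀ + m) ≤ (n + 1) * T₀ := by
    have : n' * (n * (T₀ + m)) ≤ n' * ((n + 1) * T₀) := by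
      zify at *
      nlinarith
    exact Nat.le_of_mul_le_mul_left this hn'
  have hq0 : k * (T₀ + m) ≤ k' := by
    have : n' * (k * (T₀ + m)) ≤ n' * k' := by
      rw [← hsize]
      zify at *
      nlinarith
    exact Nat.le_of_mul_le_mul_left this hn'
  obtain ⟨p, hp⟩ := Nat.exists_eq_add_of_le hp0
  obtain ⟨q, hq⟩ := Nat.exists_eq_add_of_le hq0
  refine ⟨p, q, ?_, ?_⟩
  · zify at *
    linear_combination (-k : ℤ) * hp - hq
  · intro ν hν h2 h3 hνn
    obtain ⟨x', hx'⟩ := Nat.exists_eq_add_of_le h2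
    obtain ⟨y', hy'⟩ := Nat.exists_eq_add_of_le h3
    obtain ⟨d, hd⟩ := Nat.exists_eq_add_of_le hν
    have e1 : ν * T₀ - n * l = x' := by omega
    have e2 : l + n * l - ν * (T₀ + m) = y' := by omega
    have e3 : n' - ν = d := by omega
    rw [e1, e2, e3]
    zify at *
    refine ⟨?_, ?_, ?_⟩
    · linear_combination -hx' - hy'
    · linear_combination (-(n + 1) : ℤ) * hx' - n * hy' + ν * hp
    · linear_combination (-k : ℤ) * hy' + hsize + k' * hd + ν * hq

/-- The relabellings at the two endpoints `0` and `1`. Whenever a function `M` of two points has the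
boundary behaviour of the Razak block `A_{n,k}` (up to the value `z` of the last block), the block
diagonal matrices over the pairs `(ξ_i(t), η_i(t))`, `t = 0, 1`, have that of `A_{n',k'}`. -/
theorem exists_endpoint_equiv {n k n' k' l : ℕ} (hn : 0 < n) (hn' : 0 < n')
    (hsize : n * k * l = n' * k') {ξ₀ ξ₁ η₀ η₁ : Fin l → I} (hξ₀ : Monotone ξ₀)
    (hξ₁ : Monotone ξ₁) (hη₀ : Monotone η₀) (hη₁ : Monotone η₁) {Tξ Tη : I → ℕ}
    (cξ₀ : IsCount ξ₀ ((n - 1) * l) n' Tξ) (cξ₁ : IsCount ξ₁ ((n - 1) * l) (n' - 1) Tξ)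
    (cη₀ : IsCount η₀ ((n - 1) * l) n' Tη) (cη₁ : IsCount η₁ ((n - 1) * l) (n' - 1) Tη) :
    ∃ P₀ P₁ : (Fin k × Fin n) × Fin l ≃ Fin k' × Fin n',
      ∀ a z (M : I → I → Matrix (Fin k × Fin n) (Fin k × Fin n) ℂ),
        M 0 0 = cutDiag n n k a z → M 1 1 = cutDiag (n - 1) n k a z →
        ∃ b, reindex P₀ P₀ (blockDiagonal fun i => M (ξ₀ i) (η₀ i)) = cutDiag n' n' k' b z ∧
          reindex P₁ P₁ (blockDiagonal fun i => M (ξ₁ i) (η₁ i)) = cutDiag (n' - 1) n' k' b z := by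
  obtain ⟨yξ, hyξ, hmξ⟩ := cξ₀.exists_max hn'
  obtain ⟨yη, hyη, hmη⟩ := cη₀.exists_max hn'
  -- with `s = (n - 1) l`, in both families the member of index `i` is `0` if `i + s < ν T₀` and `1` if
  -- `ν T₁ ≤ i + s`, and in between the members are constant on consecutive groups of `ν`
  obtain ⟨T₀, hT₀, hT₀ξ, hT₀η⟩ : ∃ T₀, (T₀ = Tξ 0 ∨ T₀ = Tη 0) ∧ T₀ ≤ Tξ 0 ∧ T₀ ≤ Tη 0 :=
    ⟨min (Tξ 0) (Tη 0), min_choice _ _, min_le_left _ _, min_le_right _ _⟩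
  obtain ⟨T₁, hT₁, hT₁ξ, hT₁η⟩ : ∃ T₁, (T₁ = Tξ yξ ∨ T₁ = Tη yη) ∧ Tξ yξ ≤ T₁ ∧ Tη yη ≤ T₁ :=
    ⟨max (Tξ yξ) (Tη yη), max_choice _ _, le_max_left _ _, le_max_right _ _⟩
  obtain ⟨m, rfl⟩ := Nat.exists_eq_add_of_le ((hT₀ξ.trans (hmξ 0 zero_lt_one)).trans hT₁ξ)
  have hlow₀ : (n - 1) * l ≤ n' * T₀ := by
    rcases hT₀ with h | h <;> rw [h]
    exacts [cξ₀.le_mul zero_lt_one, cη₀.le_mul zero_lt_one]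
  have hlow₁ : (n - 1) * l ≤ (n' - 1) * T₀ := by
    rcases hT₀ with h | h <;> rw [h]
    exacts [cξ₁.le_mul zero_lt_one, cη₁.le_mul zero_lt_one]
  have hup₀ : n' * (T₀ + m) ≤ l + (n - 1) * l := by
    rcases hT₁ with h | h <;> rw [h]
    exacts [cξ₀.mul_le hyξ, cη₀.mul_le hyη]
  have hup₁ : (n' - 1) * (T₀ + m) ≤ l + (n - 1) * l := by
    rcases hT₁ with h | h <;> rw [h]
    exacts [cξ₁.mul_le hyξ, cη₁.mul_le hyη]
  obtain ⟨p, q, hcard, hpq⟩ := exists_multiplicities hn hn' hsize hlow₀ hup₀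
  have e : Fin k × Fin p ⊕ Fin q ⊕ (Fin k × Fin n) × Fin m ≃ Fin k' :=
    Fintype.equivOfCardEq (by
      simp only [Fintype.card_sum, Fintype.card_prod, Fintype.card_fin]
      exact hcard)
  obtain ⟨a₀, b₀, c₀⟩ := hpq n' le_rfl hlow₀ hup₀ (.inl rfl)
  obtain ⟨a₁, b₁, c₁⟩ := hpq (n' - 1) (Nat.sub_le _ _) hlow₁ hup₁ (.inr (Nat.sub_add_cancel hn'))
  obtain ⟨P₀, hP₀⟩ := exists_block_equiv le_rfl a₀ b₀ hn c₀ e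
  obtain ⟨P₁, hP₁⟩ := exists_block_equiv (Nat.sub_le n' 1) a₁ b₁ hn c₁ e
  have hmξ' : ∀ y < 1, Tξ y ≤ T₀ + m := fun y hy => (hmξ y hy).trans hT₁ξ
  have hmη' : ∀ y < 1, Tη y ≤ T₀ + m := fun y hy => (hmη y hy).trans hT₁η
  refine ⟨P₀, P₁, fun a z M h₀ h₁ => ⟨_,
    hP₀ a z (fun j => M (countInv Tξ (T₀ + j)) (countInv Tη (T₀ + j))) _ ?_ ?_ ?_,
    hP₁ a z (fun j => M (countInv Tξ (T₀ + j)) (countInv Tη (T₀ + j))) _ ?_ ?_ ?_⟩⟩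
  · intro i hi
    rw [cξ₀.eq_zero hξ₀ hT₀ξ (by omega), cη₀.eq_zero hη₀ hT₀η (by omega), h₀]
  · intro i hi
    rw [cξ₀.eq_one hξ₀ hmξ' (by lia), cη₀.eq_one hη₀ hmη' (by lia), h₁]
  · intro i j r hi
    have : (i : ℕ) + (n - 1) * l = r + n' * (T₀ + j) := by rw [mul_add]; omega
    rw [cξ₀.eq_countInv hξ₀ r.2 this, cη₀.eq_countInv hη₀ r.2 this]
  · intro i hi
    rw [cξ₁.eq_zero hξ₁ hT₀ξ (by omega), cη₁.eq_zero hη₁ hT₀η (by omega), h₀]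
  · intro i hi
    rw [cξ₁.eq_one hξ₁ hmξ' (by lia), cη₁.eq_one hη₁ hmη' (by lia), h₁]
  · intro i j r hi
    have : (i : ℕ) + (n - 1) * l = r + (n' - 1) * (T₀ + j) := by rw [mul_add]; omega
    rw [cξ₁.eq_countInv hξ₁ r.2 this, cη₁.eq_countInv hη₁ r.2 this]

end BlockCounting

/-! ### Traces at the endpoints of a Razak block -/

section RazakBlocks

open Matrix

theorem cutDiag_self (n k : ℕ) (a : Matrix (Fin k) (Fin k) ℂ) (z : ℂ) :
    cutDiag n n k a z = blockDiagonal fun _ : Fin n => a := by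
  simp [cutDiag]

theorem lastZeroDiag_eq_cutDiag (n k : ℕ) (a : Matrix (Fin k) (Fin k) ℂ) :
    lastZeroDiag n k a = cutDiag (n - 1) n k a 0 := by
  rw [lastZeroDiag, cutDiag]
  congr 1
  funext j
  have : (j : ℕ) + 1 < n ↔ (j : ℕ) < n - 1 := by omega
  simp only [this]
  congr 1
  exact (diagonal_zero (n := Fin k) (α := ℂ)).symm

theorem mem_razakBlock {n k : ℕ} {f : MatPath (Fin k × Fin n)} :
    f ∈ razakBlock n k ↔ ∃ a, f 0 = cutDiag n n k a 0 ∧ f 1 = cutDiag (n - 1) n k a 0 := by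
  simp only [cutDiag_self, ← lastZeroDiag_eq_cutDiag]
  rfl

theorem cutDiag_one (ν n k : ℕ) (z : ℂ) :
    cutDiag ν n k 1 z = diagonal fun x => if (x.2 : ℕ) < ν then 1 else z := by
  ext ⟨i, j⟩ ⟨i', j'⟩
  simp only [cutDiag, blockDiagonal_apply, diagonal_apply, Prod.mk.injEq]
  split_ifs <;> simp_all [one_apply]

theorem cutDiag_one_one (ν n k : ℕ) : cutDiag ν n k 1 1 = 1 := by
  simp [cutDiag_one]

theorem trace_cutDiag {ν n : ℕ} (hν : ν ≤ n) (k : ℕ) (a : Matrix (Fin k) (Fin k) ℂ) (z : ℂ) :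
    (cutDiag ν n k a z).trace = ν * a.trace + ((n - ν : ℕ) : ℂ) * (k * z) := by
  have h1 : (Finset.univ.filter fun i : Fin n => (i : ℕ) < ν).card = ν := by
    rw [← Fintype.card_subtype]; exact Fin.card_subtype_val_lt hν
  have h2 : (Finset.univ.filter fun i : Fin n => ¬ (i : ℕ) < ν).card = n - ν := by
    rw [← Fintype.card_subtype]; exact Fin.card_subtype_not_val_lt hν
  rw [cutDiag, trace_blockDiagonal]
  simp only [apply_ite trace, trace_diagonal, Finset.sum_ite, Finset.sum_const, h1, h2]
  simp

/-- The path `t ↦ diag(1, …, 1, h(t))` with the last entry repeated `k` times. -/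
def lastBlockPath (n k : ℕ) (h : C(I, ℂ)) : MatPath (Fin k × Fin n) where
  toFun t := cutDiag (n - 1) n k 1 (h t)
  continuous_toFun := by
    refine Continuous.matrix_blockDiagonal (continuous_pi fun j => ?_)
    split_ifs
    · exact continuous_const
    · exact Continuous.matrix_diagonal (continuous_pi fun _ => h.continuous)

@[simp]
theorem lastBlockPath_apply (n k : ℕ) (h : C(I, ℂ)) (t : I) :
    lastBlockPath n k h t = cutDiag (n - 1) n k 1 (h t) := rfl

theorem lastBlockPath_mem {n k : ℕ} {h : C(I, ℂ)} (h0 : h 0 = 1) (h1 : h 1 = 0) :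
    lastBlockPath n k h ∈ razakBlock n k :=
  mem_razakBlock.mpr ⟨1, by
    rw [lastBlockPath_apply, h0, cutDiag_one_one, cutDiag_self]; exact blockDiagonal_one.symm, by
    rw [lastBlockPath_apply, h1]⟩

variable {ι κ : Type*} [Fintype ι] [DecidableEq ι] [Fintype κ] [DecidableEq κ]

theorem IsDiagonalWith.trace_eq {A : NonUnitalStarSubalgebra ℂ (MatPath ι)}
    {B : NonUnitalStarSubalgebra ℂ (MatPath κ)} {φ : A →⋆ₙₐ[ℂ] B} {l : ℕ} {ξ : Fin l → C(I, I)}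
    (hφ : IsDiagonalWith φ ξ) (f : A) (t : I) :
    ((φ f : MatPath κ) t).trace = ∑ i, ((f : MatPath ι) (ξ i t)).trace := by
  obtain ⟨-, e, u, hu, h⟩ := hφ
  rw [h, trace_mul_comm, ← mul_assoc, (Unitary.mem_iff.mp (hu t)).1, one_mul,
    ← trace_blockDiagonal, reindex_apply, trace, trace]
  exact Equiv.sum_comp e.symm fun i => (blockDiagonal fun i => (f : MatPath ι) (ξ i t)) i i

theorem exists_continuous_eq_indicator_le {y : I} (hy : y < 1) (S : Finset I) :
    ∃ h : C(I, ℝ), h 0 = 1 ∧ h 1 = 0 ∧ ∀ x ∈ S, h x = if x ≤ y then 1 else 0 := by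
  have hfin : (insert 1 {x ∈ (S : Set I) | y < x}).Finite :=
    (S.finite_toSet.subset (Set.sep_subset _ _)).insert 1
  obtain ⟨h, h0, h1, -⟩ := exists_continuous_zero_one_of_isClosed hfin.isClosed
    (isClosed_Iic (a := y)) (by
      rw [Set.disjoint_right]
      rintro x hx (rfl | ⟨-, hx'⟩)
      · exact absurd hy (not_lt.mpr hx)
      · exact absurd hx' (not_lt.mpr hx))
  refine ⟨h, h1 (Set.mem_Iic.mpr (unitInterval.nonneg y)), h0 (.inl rfl), fun x hx => ?_⟩
  split_ifs with hxy
  · exact h1 hxy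
  · exact h0 (.inr ⟨hx, not_le.mp hxy⟩)

/-- Comparing traces at the two endpoints of the image of `diag(1, …, 1, h)`, where `h` is `1` at
the associated points below `y` and `0` at those above `y`. -/
theorem IsDiagonalWith.exists_isCount {n k n' k' l : ℕ} (hn : 0 < n) (hk : 0 < k) (hn' : 0 < n')
    {φ : razakBlock n k →⋆ₙₐ[ℂ] razakBlock n' k'} {ξ : Fin l → C(I, I)}
    (hφ : IsDiagonalWith φ ξ) :
    ∃ T : I → ℕ, IsCount (fun i => ξ i 0) ((n - 1) * l) n' T ∧
      IsCount (fun i => ξ i 1) ((n - 1) * l) (n' - 1) T := by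
  suffices H : ∀ y < (1 : I),
      (n' - 1) * ((Finset.univ.filter fun i => ξ i 0 ≤ y).card + (n - 1) * l) =
        n' * ((Finset.univ.filter fun i => ξ i 1 ≤ y).card + (n - 1) * l) by
    refine ⟨fun y => (Finset.univ.filter fun i => ξ i 0 ≤ y).card -
      (Finset.univ.filter fun i => ξ i 1 ≤ y).card, fun y hy => ?_, fun y hy => ?_⟩
    all_goals
      have := H y hy
      obtain ⟨n', rfl⟩ := Nat.exists_eq_add_of_le' hn'
      rw [Nat.add_sub_cancel] at this
      obtain ⟨d, hd⟩ : ∃ d, (Finset.univ.filter fun i => ξ i 0 ≤ y).card =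
          (Finset.univ.filter fun i => ξ i 1 ≤ y).card + d := by
        refine Nat.exists_eq_add_of_le ?_
        by_contra! hcon
        nlinarith
      simp only [hd, Nat.add_sub_cancel_left, Nat.add_sub_cancel] at this ⊢
      nlinarith
  intro y hy
  obtain ⟨h, h0, h1, hS⟩ := exists_continuous_eq_indicator_le hy
    (Finset.univ.image (fun i => ξ i 0) ∪ Finset.univ.image (fun i => ξ i 1))
  let hC : C(I, ℂ) := ⟨fun t => (h t : ℂ), Complex.continuous_ofReal.comp h.continuous⟩
  let f : razakBlock n k := ⟨lastBlockPath n k hC, lastBlockPath_mem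
    (by simp [hC, h0]) (by simp [hC, h1])⟩
  obtain ⟨b, hb0, hb1⟩ := mem_razakBlock.mp (φ f).2
  have key : ∀ t : I, (∀ i, h (ξ i t) = if ξ i t ≤ y then 1 else 0) →
      ((φ f : MatPath (Fin k' × Fin n')) t).trace =
        k * ((Finset.univ.filter fun i => ξ i t ≤ y).card + (n - 1 : ℕ) * l) := by
    intro t ht
    rw [hφ.trace_eq]
    simp only [f, lastBlockPath_apply, trace_cutDiag (Nat.sub_le n 1), hC, ContinuousMap.coe_mk, ht,
      Nat.sub_sub_self hn, trace_one, Fintype.card_fin, Finset.sum_add_distrib, Finset.sum_const,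
      Finset.card_univ, ← Finset.mul_sum, nsmul_eq_mul, apply_ite Complex.ofReal,
      Complex.ofReal_one, Complex.ofReal_zero, Finset.sum_boole]
    ring
  have k0 := key 0 fun i => hS _ (Finset.mem_union_left _ (Finset.mem_image_of_mem _ (by simp)))
  have k1 := key 1 fun i => hS _ (Finset.mem_union_right _ (Finset.mem_image_of_mem _ (by simp)))
  rw [hb0, trace_cutDiag le_rfl] at k0
  rw [hb1, trace_cutDiag (Nat.sub_le n' 1)] at k1
  have hk' : (k : ℂ) ≠ 0 := by exact_mod_cast hk.ne'
  have : ((n' - 1 : ℕ) : ℂ) * (((Finset.univ.filter fun i => ξ i 0 ≤ y).card : ℂ) +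
      (n - 1 : ℕ) * l) = n' * ((Finset.univ.filter fun i => ξ i 1 ≤ y).card + (n - 1 : ℕ) * l) := by
    apply mul_left_cancel₀ hk'
    linear_combination -((n' - 1 : ℕ) : ℂ) * k0 + (n' : ℂ) * k1
  exact_mod_cast this

theorem IsDiagonalWith.card_eq {A : NonUnitalStarSubalgebra ℂ (MatPath ι)}
    {B : NonUnitalStarSubalgebra ℂ (MatPath κ)} {φ : A →⋆ₙₐ[ℂ] B} {l : ℕ} {ξ : Fin l → C(I, I)}
    (hφ : IsDiagonalWith φ ξ) : Fintype.card ι * l = Fintype.card κ := by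
  obtain ⟨-, e, -⟩ := hφ
  simpa using Fintype.card_congr e

end RazakBlocks

/-! ### The diagonal distance is at most the Cuntz distance -/

section RankObstruction

open Matrix

variable {ι κ : Type*} [Fintype ι] [DecidableEq ι] [Fintype κ] [DecidableEq κ]

/-- The rank is lower semicontinuous, and `rank (x⋆ b x) ≤ rank b`. -/
theorem CuntzLE.rank_le {a b : Matrix κ κ ℂ} (h : CuntzLE a b) : a.rank ≤ b.rank := by
  by_contra! hlt
  let T : Matrix κ κ ℂ →ₗ[ℂ] ((κ → ℂ) →L[ℂ] (κ → ℂ)) :=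
    LinearMap.toContinuousLinearMap.toLinearMap ∘ₗ (toLin' : Matrix κ κ ℂ ≃ₗ[ℂ] _).toLinearMap
  have hrank : ∀ M : Matrix κ κ ℂ, (M.rank : Cardinal) = (T M : (κ → ℂ) →ₗ[ℂ] (κ → ℂ)).rank :=
    fun M => by
      rw [LinearMap.rank, ← Module.finrank_eq_rank]
      rfl
  have hopen := (isOpen_setOfPred_nat_le_rank (𝕜 := ℂ) (E := κ → ℂ) (F := κ → ℂ) a.rank).preimage
    T.continuous_of_finiteDimensional
  obtain ⟨ε, hε, hball⟩ := Metric.isOpen_iff.mp hopen a (by simp [← hrank])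
  obtain ⟨x, hx⟩ := h ε hε
  have h1 := hball (mem_ball_iff_norm.mpr hx)
  simp only [Set.mem_preimage, Set.mem_ofPred_eq, ← hrank, Nat.cast_le] at h1
  have h2 := (rank_mul_le_left (star x * b) x).trans (rank_mul_le_right (star x) b)
  omega

theorem CuntzLE.map {A B : Type*} [CStarAlgebra A] [CStarAlgebra B] (π : A →⋆ₐ[ℂ] B) {a b : A}
    (h : CuntzLE a b) : CuntzLE (π a) (π b) := by
  intro ε hε
  obtain ⟨x, hx⟩ := h ε hε
  refine ⟨π x, ?_⟩
  rw [← map_star, ← map_mul, ← map_mul, ← map_sub]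
  exact (NonUnitalStarAlgHom.norm_apply_le π _).trans_lt hx

theorem Matrix.cfc_diagonal (d : κ → ℂ) {f : ℂ → ℂ} (hf : Continuous f) :
    cfc f (diagonal d) = diagonal fun i => f (d i) := by
  let π : (κ → ℂ) →⋆ₐ[ℂ] Matrix κ κ ℂ :=
    { diagonalAlgHom ℂ with map_star' := fun v => by simp [star_eq_conjTranspose] }
  have h1 : cfc f d = fun i => f (d i) := by
    rw [cfc_map_pi (S := ℂ) f d hf.continuousOn ⟨mul_comm _ _⟩ fun i => ⟨mul_comm _ _⟩]
    funext i
    exact cfc_algebraMap (A := ℂ) (d i) f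
  have h2 := StarAlgHomClass.map_cfc π f d hf.continuousOn
    (LinearMap.continuous_of_finiteDimensional (π : (κ → ℂ) →ₗ[ℂ] Matrix κ κ ℂ))
    ⟨mul_comm _ _⟩ ⟨by
      change star (diagonal d) * diagonal d = diagonal d * star (diagonal d)
      rw [star_eq_conjTranspose, diagonal_conjTranspose, diagonal_mul_diagonal,
        diagonal_mul_diagonal]
      simp_rw [mul_comm]⟩
  rw [h1] at h2
  exact h2.symm

theorem Matrix.rank_cfc_unitary_conj_diagonal {W : Matrix κ κ ℂ} (hW : W ∈ unitaryGroup κ ℂ)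
    (d : κ → ℂ) (f : C(ℂ, ℝ)) :
    (cfc (fun z : ℂ => (f z : ℂ)) (W * diagonal d * star W)).rank =
      (Finset.univ.filter fun i => f (d i) ≠ 0).card := by
  have hf : Continuous fun z : ℂ => (f z : ℂ) := Complex.continuous_ofReal.comp f.continuous
  have hd : IsStarNormal (diagonal d) := ⟨by
      change star (diagonal d) * diagonal d = diagonal d * star (diagonal d)
      rw [star_eq_conjTranspose, diagonal_conjTranspose, diagonal_mul_diagonal,
        diagonal_mul_diagonal]
      simp_rw [mul_comm]⟩
  have h := StarAlgHomClass.map_cfc (Unitary.conjStarAlgAut ℂ (Matrix κ κ ℂ) ⟨W, hW⟩)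
    (fun z : ℂ => (f z : ℂ)) (diagonal d) hf.continuousOn
    (by
      have : ⇑(Unitary.conjStarAlgAut ℂ (Matrix κ κ ℂ) ⟨W, hW⟩) = fun x => W * x * star W := by
        funext x; simp [Unitary.conjStarAlgAut_apply]
      rw [this]; fun_prop) hd (hd.map _)
  simp only [Unitary.conjStarAlgAut_apply, cfc_diagonal d hf] at h
  have hdet : IsUnit W.det := (isUnit_iff_isUnit_det W).mp (Unitary.isUnit_coe (U := ⟨W, hW⟩))
  have hdet' : IsUnit (star W).det := (isUnit_iff_isUnit_det _).mp
    (Unitary.isUnit_coe (U := ⟨star W, Unitary.star_mem hW⟩))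
  refine (congrArg Matrix.rank h.symm).trans ?_
  rw [rank_mul_eq_left_of_isUnit_det _ _ hdet', rank_mul_eq_right_of_isUnit_det _ _ hdet,
    rank_diagonal, Fintype.card_subtype]
  simp

theorem exists_continuous_support_eq {X : Type*} [PseudoMetricSpace X] {U : Set X}
    (hU : IsOpen U) : ∃ f : C(X, ℝ), 0 ≤ f ∧ Function.support f = U := by
  rcases eq_or_ne U Set.univ with rfl | hne
  · exact ⟨1, zero_le_one, by ext; simp⟩
  · refine ⟨⟨fun x => Metric.infDist x Uᶜ, Metric.continuous_infDist_pt _⟩,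
      fun x => Metric.infDist_nonneg, ?_⟩
    ext x
    have := hU.isClosed_compl.mem_iff_infDist_zero (Set.nonempty_compl.mpr hne) (x := x)
    rw [Function.mem_support, ContinuousMap.coe_mk, ne_eq, ← this, Set.notMem_compl_iff]

theorem Matrix.reindex_blockDiagonal_mem_unitaryGroup {o : Type*} [Fintype o] [DecidableEq o]
    (e : ι × o ≃ κ) {G : o → Matrix ι ι ℂ} (hG : ∀ i, G i ∈ unitaryGroup ι ℂ) :
    reindex e e (blockDiagonal G) ∈ unitaryGroup κ ℂ := by
  rw [mem_unitaryGroup_iff, star_eq_conjTranspose, conjTranspose_reindex,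
    blockDiagonal_conjTranspose, reindex_apply, reindex_apply, submatrix_mul_equiv,
    ← blockDiagonal_mul]
  have : (fun i => G i * (G i)ᴴ) = 1 := funext fun i => mem_unitaryGroup_iff.mp (hG i)
  rw [this, blockDiagonal_one, submatrix_one_equiv]

/-- If `f_U(a) ≾ f_V(b)`, then in every finite-dimensional representation the eigenvalues of `a`
in `U` are at most as many as those of `b` in `V`. -/
theorem OpenCuntzLE.card_le {B : Type*} [NonUnitalCStarAlgebra B] {U V : Set ℂ} {a b : B}
    (h : OpenCuntzLE U V a b) (hU : IsOpen U) (hV : IsOpen V) (ha : IsStarNormal a)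
    (hb : IsStarNormal b) (ev : B →⋆ₙₐ[ℂ] Matrix κ κ ℂ) {W W' : Matrix κ κ ℂ}
    (hW : W ∈ unitaryGroup κ ℂ) (hW' : W' ∈ unitaryGroup κ ℂ) {d d' : κ → ℂ}
    (hat : ev a = W * diagonal d * star W) (hbt : ev b = W' * diagonal d' * star W')
    [DecidablePred (· ∈ U)] [DecidablePred (· ∈ V)] :
    (Finset.univ.filter fun i => d i ∈ U).card ≤ (Finset.univ.filter fun i => d' i ∈ V).card := by
  obtain ⟨f, hf, hfU⟩ := exists_continuous_support_eq hU
  obtain ⟨g, hg, hgV⟩ := exists_continuous_support_eq hV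
  let π : Unitization ℂ B →⋆ₐ[ℂ] Matrix κ κ ℂ := Unitization.starLift ev
  have hπ : ∀ c : B, π (c : Unitization ℂ B) = ev c := fun c =>
    DFunLike.congr_fun (Unitization.starLift.symm_apply_apply ev) c
  have hπc : Continuous π := AddMonoidHomClass.continuous_of_bound π 1 fun x => by
    simpa using NonUnitalStarAlgHom.norm_apply_le π x
  have hcfc : ∀ (c : B) (f : C(ℂ, ℝ)), IsStarNormal c →
      π (cfc (fun z : ℂ => (f z : ℂ)) (c : Unitization ℂ B)) =
        cfc (fun z : ℂ => (f z : ℂ)) (ev c) := fun c f hc => by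
    have hn : IsStarNormal (c : Unitization ℂ B) := by
      exact hc.map (Unitization.inrNonUnitalStarAlgHom ℂ B)
    rw [← hπ c]
    exact StarAlgHomClass.map_cfc π _ _
      (Complex.continuous_ofReal.comp f.continuous).continuousOn hπc hn (hn.map π)
  have h1 := ((h f g hf hg hfU hgV).map π).rank_le
  rw [hcfc a f ha, hcfc b g hb, hat, hbt, rank_cfc_unitary_conj_diagonal hW,
    rank_cfc_unitary_conj_diagonal hW'] at h1
  convert h1 using 4
  · rw [← hfU]; rfl
  · rw [← hgV]; rfl

theorem IsDiagonalWith.exists_diagonalize {A : NonUnitalStarSubalgebra ℂ (MatPath ι)}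
    {B : NonUnitalStarSubalgebra ℂ (MatPath κ)} {φ : A →⋆ₙₐ[ℂ] B} {l : ℕ} {ξ : Fin l → C(I, I)}
    (hφ : IsDiagonalWith φ ξ) {f : A} {w : I → Matrix ι ι ℂ} (hw : ∀ t, w t ∈ unitaryGroup ι ℂ)
    {d : I → ι → ℂ} (hf : ∀ t, (f : MatPath ι) t = w t * diagonal (d t) * star (w t)) (t : I) :
    ∃ e : ι × Fin l ≃ κ, ∃ W ∈ unitaryGroup κ ℂ, (φ f : MatPath κ) t =
      W * diagonal (fun x => d (ξ (e.symm x).2 t) (e.symm x).1) * star W := by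
  obtain ⟨-, e, u, hu, h⟩ := hφ
  have hG : reindex e e (blockDiagonal fun i => w (ξ i t)) ∈ unitaryGroup κ ℂ :=
    reindex_blockDiagonal_mem_unitaryGroup e fun i => hw _
  refine ⟨e, u t * reindex e e (blockDiagonal fun i => w (ξ i t)), mul_mem (hu t) hG, ?_⟩
  have key : reindex e e (blockDiagonal fun i => (f : MatPath ι) (ξ i t)) =
      reindex e e (blockDiagonal fun i => w (ξ i t)) *
        diagonal (fun x => d (ξ (e.symm x).2 t) (e.symm x).1) *
        star (reindex e e (blockDiagonal fun i => w (ξ i t))) := by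
    have h1 : diagonal (fun x => d (ξ (e.symm x).2 t) (e.symm x).1) =
        reindex e e (blockDiagonal fun i => diagonal (d (ξ i t))) := by
      rw [blockDiagonal_diagonal, reindex_apply, submatrix_diagonal_equiv]
      rfl
    rw [h1, star_eq_conjTranspose, conjTranspose_reindex, blockDiagonal_conjTranspose]
    simp only [reindex_apply, submatrix_mul_equiv, ← blockDiagonal_mul]
    simp only [hf, star_eq_conjTranspose]
  rw [h, key, star_mul]
  noncomm_ring

/-- The function `diag(1, …, 1, 1 - t)` is conjugate to an element of every Lipschitz family. -/
theorem IsLipschitzFamily.exists_conj_lastBlock {n k : ℕ} {L : Set (razakBlock n k)}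
    (hL : IsLipschitzFamily L) :
    ∃ f ∈ L, IsSelfAdjoint f ∧ ∃ w : I → Matrix (Fin k × Fin n) (Fin k × Fin n) ℂ,
      (∀ t, w t ∈ unitaryGroup (Fin k × Fin n) ℂ) ∧
      ∀ t : I, (f : MatPath (Fin k × Fin n)) t = w t *
        diagonal (fun x => if (x.2 : ℕ) < n - 1 then 1 else ((1 - t : ℝ) : ℂ)) * star (w t) := by
  obtain ⟨u, hu, -, -, hLu⟩ := hL
  let h : C(I, ℂ) := ⟨fun t => ((1 - t : ℝ) : ℂ), by fun_prop⟩
  have h1 : ∀ t, star (u t) * u t = 1 := fun t => (Unitary.mem_iff.mp (hu t)).1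
  have h2 : ∀ t, u t * star (u t) = 1 := fun t => (Unitary.mem_iff.mp (hu t)).2
  have hconj : star u * u = 1 := ContinuousMap.ext h1
  -- conjugating by the constant `u 1` makes `u g u⋆` equal to `diag(1, …, 1, 0)` at the endpoint `1`
  let g : MatPath (Fin k × Fin n) :=
    .const I (star (u 1)) * lastBlockPath n k h * .const I (u 1)
  have hg : ∀ t, g t = star (u 1) * cutDiag (n - 1) n k 1 (h t) * u 1 := fun t => rfl
  have hmem : u * g * star u ∈ razakBlock n k := by
    refine mem_razakBlock.mpr ⟨1, ?_, ?_⟩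
    · have : h 0 = 1 := by simp [h]
      simp only [ContinuousMap.mul_apply, ContinuousMap.star_apply, hg, this, cutDiag_one_one,
        mul_one, h1, h2, cutDiag_self]
      exact blockDiagonal_one.symm
    · have : h 1 = 0 := by simp [h]
      simp only [ContinuousMap.mul_apply, ContinuousMap.star_apply, hg, this]
      rw [show u 1 * (star (u 1) * cutDiag (n - 1) n k 1 0 * u 1) * star (u 1) =
        (u 1 * star (u 1)) * cutDiag (n - 1) n k 1 0 * (u 1 * star (u 1)) by noncomm_ring, h2,
        one_mul, mul_one]
  have hnorm : ∀ M : Matrix (Fin k × Fin n) (Fin k × Fin n) ℂ,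
      ‖star (u 1) * M * u 1‖ = ‖M‖ := fun M => by
    rw [CStarRing.norm_mul_mem_unitary _ (hu 1),
      CStarRing.norm_mem_unitary_mul _ (Unitary.star_mem (hu 1))]
  have hgsa : IsSelfAdjoint g := by
    refine ContinuousMap.ext fun t => ?_
    rw [ContinuousMap.star_apply, hg, star_mul, star_mul, star_star, mul_assoc]
    congr 2
    rw [cutDiag_one, star_eq_conjTranspose, diagonal_conjTranspose]
    congr 1
    funext x
    by_cases hx : (x.2 : ℕ) < n - 1 <;> simp [hx, h]
  have hlip : g ∈ lipUnit ((fun f => star u * f * u) '' (razakBlock n k : Set _)) := by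
    refine ⟨⟨u * g * star u, hmem, ?_⟩, hgsa, ?_, fun x y => ?_⟩
    · calc star u * (u * g * star u) * u = (star u * u) * g * (star u * u) := by noncomm_ring
        _ = g := by rw [hconj, one_mul, mul_one]
    · refine (ContinuousMap.norm_le _ zero_le_one).mpr fun t => ?_
      rw [hg, hnorm, cutDiag_one, l2_opNorm_diagonal]
      refine (pi_norm_le_iff_of_nonneg zero_le_one).mpr fun x => ?_
      split_ifs
      · simp
      · simp only [h, ContinuousMap.coe_mk, Complex.norm_real, Real.norm_eq_abs]
        exact abs_le.mpr ⟨by linarith [t.2.2], by linarith [t.2.1]⟩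
    · rw [hg, hg, ← sub_mul, ← mul_sub, hnorm, cutDiag_one, cutDiag_one, diagonal_sub,
        l2_opNorm_diagonal]
      refine (pi_norm_le_iff_of_nonneg (abs_nonneg _)).mpr fun z => ?_
      by_cases hz : (z.2 : ℕ) < n - 1
      · simp [hz]
      · simp only [hz, if_false, h, ContinuousMap.coe_mk]
        rw [← Complex.ofReal_sub, Complex.norm_real, Real.norm_eq_abs, abs_sub_comm]
        exact (congrArg _ (by ring)).le
  obtain ⟨f, hfL, hf⟩ : u * g * star u ∈ ((↑) : razakBlock n k → MatPath (Fin k × Fin n)) '' L :=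
    hLu ▸ ⟨g, hlip, rfl⟩
  refine ⟨f, hfL, ?_, fun t => u t * star (u 1),
    fun t => mul_mem (hu t) (Unitary.star_mem (hu 1)), fun t => ?_⟩
  · apply Subtype.ext
    change star (f : MatPath (Fin k × Fin n)) = f
    rw [hf]
    exact hgsa.conjugate u
  · rw [hf, ContinuousMap.mul_apply, ContinuousMap.mul_apply, ContinuousMap.star_apply, hg,
      cutDiag_one, star_mul, star_star]
    simp only [h, ContinuousMap.coe_mk]
    noncomm_ring

theorem re_lt_of_mem_thickening {c r : ℝ} {z : ℂ}
    (hz : z ∈ Metric.thickening r {z : ℂ | c < z.re}) : c - r < z.re := by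
  obtain ⟨y, hy, hyz⟩ := Metric.mem_thickening_iff.mp hz
  have h1 := (Complex.abs_re_le_norm (z - y)).trans_lt (dist_eq_norm z y ▸ hyz)
  rw [Complex.sub_re] at h1
  have h2 := (abs_lt.mp h1).1
  have h3 : c < y.re := hy
  linarith

/-- Eigenvalue counting for `diag(1, …, 1, 1 - t)`: if `1 - η_i(t) ≤ c - r` while
`c < 1 - ξ_i(t)`, then, the associated maps being increasing in `i`, strictly more eigenvalues of
`φ(f)(t)` exceed `c` than eigenvalues of `ψ(f)(t)` exceed `c - r`. -/
theorem IsDiagonalWith.lt_of_openCuntzLE {n k n' k' l : ℕ} (hn : 0 < n) (hk : 0 < k)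
    {φ ψ : razakBlock n k →⋆ₙₐ[ℂ] razakBlock n' k'} {ξ η : Fin l → C(I, I)}
    (hφ : IsDiagonalWith φ ξ) (hψ : IsDiagonalWith ψ η) {f : razakBlock n k}
    (hf : IsSelfAdjoint f) {w : I → Matrix (Fin k × Fin n) (Fin k × Fin n) ℂ}
    (hw : ∀ t, w t ∈ unitaryGroup (Fin k × Fin n) ℂ)
    (hfw : ∀ t : I, (f : MatPath (Fin k × Fin n)) t = w t *
      diagonal (fun x => if (x.2 : ℕ) < n - 1 then 1 else ((1 - t : ℝ) : ℂ)) * star (w t))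
    {t : I} {i : Fin l} {c r : ℝ} (hc : c < 1 - ξ i t) (hr : 0 < r)
    (h : OpenCuntzLE (B := razakBlock n' k') {z : ℂ | c < z.re}
      (Metric.thickening r {z : ℂ | c < z.re}) (φ f) (ψ f)) :
    c - r < 1 - η i t := by
  classical
  by_contra! hcon
  obtain ⟨e, W, hW, hφt⟩ := hφ.exists_diagonalize hw hfw t
  obtain ⟨e', W', hW', hψt⟩ := hψ.exists_diagonalize hw hfw t
  let ev : razakBlock n' k' →⋆ₙₐ[ℂ] Matrix (Fin k' × Fin n') (Fin k' × Fin n') ℂ :=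
    { toFun := fun c => (c : MatPath (Fin k' × Fin n')) t
      map_smul' := fun _ _ => rfl
      map_zero' := rfl
      map_add' := fun _ _ => rfl
      map_mul' := fun _ _ => rfl
      map_star' := fun _ => rfl }
  have hU : IsOpen {z : ℂ | c < z.re} := isOpen_lt continuous_const Complex.continuous_re
  have hcard := h.card_le hU Metric.isOpen_thickening (hf.map φ).isStarNormal
    (hf.map ψ).isStarNormal ev hW hW' hφt hψt
  have hsub : ∀ z : ℂ, z ∈ {z : ℂ | c < z.re} → z ∈ Metric.thickening r {z : ℂ | c < z.re} :=
    fun z hz => Metric.self_subset_thickening hr _ hz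
  have hc1 : (1 : ℂ) ∈ {z : ℂ | c < z.re} := by
    have := (ξ i t).2.1
    simp only [Set.mem_ofPred_eq, Complex.one_re]
    linarith
  let d : C(I, I) → (Fin k × Fin n) → ℂ := fun τ x =>
    if (x.2 : ℕ) < n - 1 then 1 else ((1 - τ t : ℝ) : ℂ)
  have hbij : ∀ (ζ : Fin l → C(I, I)) (V : Set ℂ)
      (e : (Fin k × Fin n) × Fin l ≃ Fin k' × Fin n'),
      (Finset.univ.filter fun x => d (ζ (e.symm x).2) (e.symm x).1 ∈ V).card =
        (Finset.univ.filter fun x : (Fin k × Fin n) × Fin l => d (ζ x.2) x.1 ∈ V).card := by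
    intro ζ V e
    exact Finset.card_equiv e.symm (by simp)
  have hcard' : (Finset.univ.filter fun x : (Fin k × Fin n) × Fin l =>
      d (ξ x.2) x.1 ∈ {z : ℂ | c < z.re}).card ≤
      (Finset.univ.filter fun x : (Fin k × Fin n) × Fin l =>
        d (η x.2) x.1 ∈ Metric.thickening r {z : ℂ | c < z.re}).card := by
    rw [← hbij ξ _ e, ← hbij η _ e']
    convert hcard
  refine absurd hcard' (not_le.mpr (Finset.card_lt_card ?_))
  refine (Finset.ssubset_iff_of_subset fun x hx => ?_).mpr
    ⟨((⟨0, hk⟩, ⟨n - 1, by omega⟩), i), ?_, ?_⟩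
  · simp only [Finset.mem_filter, Finset.mem_univ, true_and, d] at hx ⊢
    split_ifs at hx ⊢ with hxn
    · exact hc1
    · have h1 := re_lt_of_mem_thickening hx
      rw [Complex.ofReal_re] at h1
      have h2 : x.2 ≤ i := by
        by_contra! hlt
        have : η i t ≤ η x.2 t := hψ.1 t hlt.le
        have : (η i t : ℝ) ≤ η x.2 t := this
        linarith
      have h3 : (ξ x.2 t : ℝ) ≤ ξ i t := hφ.1 t h2
      rw [Set.mem_ofPred_eq, Complex.ofReal_re]
      linarith
  · simpa [d] using hc
  · simp only [Finset.mem_filter, Finset.mem_univ, true_and, d, lt_irrefl, if_false]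
    intro hx
    have h1 := re_lt_of_mem_thickening hx
    rw [Complex.ofReal_re] at h1
    linarith

/-- The half planes `{Re z > c}` with `c` slightly below `1 - ξ_i(t)` or `1 - η_i(t)`, whichever is
larger, detect `|ξ_i(t) - η_i(t)|`. -/
theorem diagonalDist_le_cuntzDist {n k n' k' l : ℕ} (hn : 0 < n) (hk : 0 < k)
    {φ ψ : razakBlock n k →⋆ₙₐ[ℂ] razakBlock n' k'} {ξ η : Fin l → C(I, I)}
    (hφ : IsDiagonalWith φ ξ) (hψ : IsDiagonalWith ψ η) {L : Set (razakBlock n k)}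
    (hL : IsLipschitzFamily L) :
    diagonalDist ξ η ≤ cuntzDist (B := razakBlock n' k') L φ ψ := by
  obtain ⟨f, hfL, hf, w, hw, hfw⟩ := hL.exists_conj_lastBlock
  refine iSup₂_le fun t i => le_trans ?_ (le_iSup₂_of_le f hfL le_rfl)
  refine ENNReal.le_of_forall_pos_le_add fun δ hδ _ => ?_
  have hδ' : (0 : ℝ) < δ := hδ
  have key : ∀ c : ℝ, (∀ r : ℝ, 0 < r →
      OpenCuntzLE (B := razakBlock n' k') {z : ℂ | c < z.re}
        (Metric.thickening r {z : ℂ | c < z.re}) (φ f) (ψ f) →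
      OpenCuntzLE (B := razakBlock n' k') {z : ℂ | c < z.re}
        (Metric.thickening r {z : ℂ | c < z.re}) (ψ f) (φ f) →
      |(ξ i t : ℝ) - η i t| ≤ r + δ) →
      edist (ξ i t) (η i t) ≤ cuntzDistElem (B := razakBlock n' k') (φ f) (ψ f) + δ := by
    intro c hc
    refine le_trans ?_ (add_le_add_left (le_iSup₂_of_le {z : ℂ | c < z.re}
      (isOpen_lt continuous_const Complex.continuous_re) le_rfl) _)
    rw [← tsub_le_iff_right]
    refine le_iInf₂ fun r hr => le_iInf fun h => ?_
    rw [tsub_le_iff_right, edist_dist, Subtype.dist_eq, Real.dist_eq]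
    refine (ENNReal.ofReal_le_ofReal (hc r hr h.1 h.2)).trans ?_
    rw [ENNReal.ofReal_add hr.le hδ'.le, ENNReal.ofReal_coe_nnreal]
  rcases le_total (ξ i t : ℝ) (η i t) with hle | hle
  · refine key (1 - ξ i t - δ) fun r hr h _ => ?_
    have := hφ.lt_of_openCuntzLE hn hk hψ hf hw hfw (by linarith) hr h
    rw [abs_of_nonpos (by linarith)]
    linarith
  · refine key (1 - η i t - δ) fun r hr _ h => ?_
    have := hψ.lt_of_openCuntzLE hn hk hφ hf hw hfw (by linarith) hr h
    rw [abs_of_nonneg (by linarith)]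
    linarith

end RankObstruction

/-! ### Continuous approximate diagonalization -/

section UnitaryEquivalence

open Matrix

variable {ι κ : Type*} [Fintype ι] [DecidableEq ι] [Fintype κ] [DecidableEq κ]

theorem cutDiag_mul (ν n k : ℕ) (a b : Matrix (Fin k) (Fin k) ℂ) (x y : ℂ) :
    cutDiag ν n k a x * cutDiag ν n k b y = cutDiag ν n k (a * b) (x * y) := by
  rw [cutDiag, cutDiag, cutDiag, ← blockDiagonal_mul]
  congr 1
  funext j
  split_ifs
  · rfl
  · rw [diagonal_mul_diagonal]

theorem star_cutDiag (ν n k : ℕ) (a : Matrix (Fin k) (Fin k) ℂ) (x : ℂ) :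
    star (cutDiag ν n k a x) = cutDiag ν n k (star a) (star x) := by
  rw [cutDiag, cutDiag, star_eq_conjTranspose, blockDiagonal_conjTranspose]
  congr 1
  funext j
  split_ifs
  · rfl
  · rw [diagonal_conjTranspose]; rfl

theorem cutDiag_sub (ν n k : ℕ) (a b : Matrix (Fin k) (Fin k) ℂ) (x y : ℂ) :
    cutDiag ν n k a x - cutDiag ν n k b y = cutDiag ν n k (a - b) (x - y) := by
  rw [cutDiag, cutDiag, cutDiag, ← blockDiagonal_sub]
  congr 1
  funext j
  simp only [Pi.sub_apply]
  split_ifs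
  · rfl
  · rw [diagonal_sub]

theorem cutDiag_mem_unitaryGroup (ν n : ℕ) {k : ℕ} {β : Matrix (Fin k) (Fin k) ℂ}
    (hβ : β ∈ unitaryGroup (Fin k) ℂ) : cutDiag ν n k β 1 ∈ unitaryGroup (Fin k × Fin n) ℂ := by
  rw [mem_unitaryGroup_iff, star_cutDiag, cutDiag_mul, mem_unitaryGroup_iff.mp hβ, star_one,
    mul_one, cutDiag_one_one]

/-- The unital embedding of `⨁_i M_ι` into `M_κ` as block diagonal matrices. -/
def blockDiagonalHom {o : Type*} [Fintype o] [DecidableEq o] (e : ι × o ≃ κ) :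
    (o → Matrix ι ι ℂ) →⋆ₐ[ℂ] Matrix κ κ ℂ where
  toFun G := reindex e e (blockDiagonal G)
  map_one' := by rw [blockDiagonal_one, reindex_apply, submatrix_one_equiv]
  map_mul' G H := by
    rw [Pi.mul_def, blockDiagonal_mul, reindex_apply, reindex_apply, reindex_apply,
      submatrix_mul_equiv]
  map_zero' := by rw [blockDiagonal_zero]; rfl
  map_add' G H := by rw [blockDiagonal_add]; rfl
  commutes' c := by
    have : blockDiagonal (algebraMap ℂ (o → Matrix ι ι ℂ) c) = c • 1 := by
      rw [← blockDiagonal_one, ← blockDiagonal_smul, Algebra.algebraMap_eq_smul_one]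
    rw [this, Algebra.algebraMap_eq_smul_one, reindex_apply, submatrix_smul, Pi.smul_apply,
      Pi.smul_apply, submatrix_one_equiv]
  map_star' G := by
    rw [star_eq_conjTranspose, conjTranspose_reindex, blockDiagonal_conjTranspose]
    rfl

theorem norm_blockDiagonalHom_le {o : Type*} [Fintype o] [DecidableEq o] (e : ι × o ≃ κ)
    {G : o → Matrix ι ι ℂ} {d : ℝ} (hd : 0 ≤ d) (hG : ∀ i, ‖G i‖ ≤ d) :
    ‖blockDiagonalHom e G‖ ≤ d :=
  (NonUnitalStarAlgHom.norm_apply_le _ _).trans ((pi_norm_le_iff_of_nonneg hd).mpr hG)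

theorem continuous_blockDiagonalHom {o : Type*} [Fintype o] [DecidableEq o] (e : ι × o ≃ κ) :
    Continuous (blockDiagonalHom e) :=
  LinearMap.continuous_of_finiteDimensional
    ((blockDiagonalHom e).toAlgHom.toLinearMap : (o → Matrix ι ι ℂ) →ₗ[ℂ] Matrix κ κ ℂ)

/-- The permutation matrix which carries the labelling `P` of the standard basis to the
labelling `e`. -/
def relabel {α : Type*} (e P : α ≃ κ) : Matrix κ κ ℂ :=
  (1 : Matrix κ κ ℂ).submatrix (e.symm.trans P) id

theorem relabel_mul_mul_star {α : Type*} (e P : α ≃ κ) (X : Matrix α α ℂ) :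
    relabel e P * reindex P P X * star (relabel e P) = reindex e e X := by
  ext i j
  simp [relabel, mul_apply, one_apply, star_eq_conjTranspose]

theorem relabel_mem_unitaryGroup {α : Type*} [DecidableEq α] (e P : α ≃ κ) :
    relabel e P ∈ unitaryGroup κ ℂ := by
  have := relabel_mul_mul_star e P 1
  rwa [reindex_apply, reindex_apply, submatrix_one_equiv, submatrix_one_equiv, mul_one,
    ← mem_unitaryGroup_iff] at this

/-- Cancellation of multiplicity, for a unitary intertwiner. -/
theorem Matrix.exists_unitary_of_blockDiagonal {ν : Type*} [Fintype ν] [DecidableEq ν] [Nonempty ν]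
    {Q : Matrix (κ × ν) (κ × ν) ℂ} (hQ : Q ∈ unitaryGroup (κ × ν) ℂ) :
    ∃ β ∈ unitaryGroup κ ℂ, ∀ E b : Matrix κ κ ℂ,
      Q * blockDiagonal (fun _ => E) * star Q = blockDiagonal (fun _ => b) →
        β * E * star β = b := by
  have h1 : star Q * Q = 1 := (Unitary.mem_iff.mp hQ).1
  have h2 : Q * star Q = 1 := (Unitary.mem_iff.mp hQ).2
  obtain ⟨β, hβ, h⟩ := exists_unitary_intertwiner
    {d : Matrix κ κ ℂ × Matrix κ κ ℂ |
      Q * blockDiagonal (fun _ : ν => d.1) * star Q = blockDiagonal fun _ => d.2}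
    (fun d hd => by
      have := congrArg star (hd : _ = _)
      simp only [star_mul, star_eq_conjTranspose, conjTranspose_conjTranspose,
        blockDiagonal_conjTranspose] at this
      simp only [Set.mem_ofPred_eq, ← this, star_eq_conjTranspose, mul_assoc]) Q
    (fun v hv => by
      rw [← one_mulVec v, ← h1, ← mulVec_mulVec, hv, mulVec_zero])
    (fun d hd i j => by
      have h3 : Q * blockDiagonal (fun _ : ν => d.1) = blockDiagonal (fun _ => d.2) * Q := by
        rw [← (hd : _ = _), mul_assoc _ (star Q), h1, mul_one]
      ext x y
      have := congrFun₂ h3 (x, i) (y, j)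
      simpa [mul_apply, blockDiagonal_apply, Fintype.sum_prod_type, Finset.sum_ite_eq] using this)
  refine ⟨β, hβ, fun E b hE => ?_⟩
  rw [h (E, b) hE, mul_assoc, (Unitary.mem_iff.mp hβ).2, mul_one]

/-- A unitary `1 + j(y)`, with `j` an embedding of the non-unital `B` in a unital algebra, acts
on `B` as the unitary `1 + y` of the unitization does. -/
theorem exists_unitary_unitization {A B : Type*} [CStarAlgebra A] [NonUnitalCStarAlgebra B]
    (j : B →⋆ₙₐ[ℂ] A) (hj : Function.Injective j) {y : B} (hy : 1 + j y ∈ unitary A) :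
    ∃ u : unitary (Unitization ℂ B), ∀ b c : B,
      ‖(u : Unitization ℂ B) * (b : Unitization ℂ B) * star (u : Unitization ℂ B)
        - (c : Unitization ℂ B)‖ = ‖(1 + j y) * j b * star (1 + j y) - j c‖ := by
  obtain ⟨h1, h2⟩ := Unitary.mem_iff.mp hy
  have h1' : y + star y + star y * y = 0 := hj (by
    rw [map_add, map_add, map_mul, map_star, map_zero,
      show j y + star (j y) + star (j y) * j y = star (1 + j y) * (1 + j y) - 1 by
        rw [star_add, star_one]; noncomm_ring, h1, sub_self])
  have h2' : y + star y + y * star y = 0 := hj (by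
    rw [map_add, map_add, map_mul, map_star, map_zero,
      show j y + star (j y) + j y * star (j y) = (1 + j y) * star (1 + j y) - 1 by
        rw [star_add, star_one]; noncomm_ring, h2, sub_self])
  have hu : (1 + (y : Unitization ℂ B)) ∈ unitary (Unitization ℂ B) := by
    rw [Unitary.mem_iff, star_add, star_one, ← Unitization.inr_star]
    constructor
    · calc (1 + ((star y : B) : Unitization ℂ B)) * (1 + (y : Unitization ℂ B))
          = 1 + (y + (star y : B) + (star y : B) * y) := by noncomm_ring
        _ = 1 := by
          rw [← Unitization.inr_mul, ← Unitization.inr_add, ← Unitization.inr_add, h1',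
            Unitization.inr_zero, add_zero]
    · calc (1 + (y : Unitization ℂ B)) * (1 + ((star y : B) : Unitization ℂ B))
          = 1 + (y + (star y : B) + y * (star y : B)) := by noncomm_ring
        _ = 1 := by
          rw [← Unitization.inr_mul, ← Unitization.inr_add, ← Unitization.inr_add, h2',
            Unitization.inr_zero, add_zero]
  refine ⟨⟨_, hu⟩, fun b c => ?_⟩
  have e1 : (1 + (y : Unitization ℂ B)) * (b : Unitization ℂ B) * star (1 + (y : Unitization ℂ B)) -
      (c : Unitization ℂ B) = ((b + y * b + b * star y + y * b * star y - c : B) :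
        Unitization ℂ B) := by
    simp only [Unitization.inr_sub, Unitization.inr_add, Unitization.inr_mul, Unitization.inr_star,
      star_add, star_one]
    noncomm_ring
  have e2 : (1 + j y) * j b * star (1 + j y) - j c =
      j (b + y * b + b * star y + y * b * star y - c) := by
    simp only [map_sub, map_add, map_mul, map_star, star_add, star_one]
    noncomm_ring
  rw [e1, e2, Unitization.norm_inr, NonUnitalStarAlgHom.norm_map j hj]

/-- A diagonal homomorphism is implemented, up to `ε` on a finite set, by a continuous path of
unitaries whose endpoints have the form of the endpoints of an element of the Razak block `A_{n',k'}`
(with `1` in place of `0`) up to the relabelling of the basis at the endpoint `1`. -/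
theorem IsDiagonalWith.exists_continuous_unitary {n k n' k' l : ℕ} (hn' : 0 < n')
    {φ : razakBlock n k →⋆ₙₐ[ℂ] razakBlock n' k'} {ξ : Fin l → C(I, I)} (hφ : IsDiagonalWith φ ξ)
    {P₀ P₁ : (Fin k × Fin n) × Fin l ≃ Fin k' × Fin n'}
    (hP : ∀ f : razakBlock n k, ∃ b,
      blockDiagonalHom P₀ (fun i => (f : MatPath (Fin k × Fin n)) (ξ i 0)) = cutDiag n' n' k' b 0 ∧
      blockDiagonalHom P₁ (fun i => (f : MatPath (Fin k × Fin n)) (ξ i 1)) =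
        cutDiag (n' - 1) n' k' b 0)
    (F : Finset (razakBlock n k)) (hF : ∀ f ∈ F, IsSelfAdjoint f) {ε : ℝ} (hε : 0 < ε) :
    ∃ β ∈ unitaryGroup (Fin k') ℂ, ∃ v : C(I, unitary (Matrix (Fin k' × Fin n') (Fin k' × Fin n') ℂ)),
      (v 0 : Matrix (Fin k' × Fin n') (Fin k' × Fin n') ℂ) = cutDiag n' n' k' β 1 ∧
      (v 1 : Matrix (Fin k' × Fin n') (Fin k' × Fin n') ℂ) =
        cutDiag (n' - 1) n' k' β 1 * relabel P₁ P₀ ∧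
      ∀ t, ∀ f ∈ F, ‖(φ f : MatPath (Fin k' × Fin n')) t - v t *
        blockDiagonalHom P₀ (fun i => (f : MatPath (Fin k × Fin n)) (ξ i t)) *
          star (v t : Matrix (Fin k' × Fin n') (Fin k' × Fin n') ℂ)‖ < ε := by
  obtain ⟨-, e, u, hu, h⟩ := hφ
  have hu' : ∀ t, u t * relabel e P₀ ∈ unitaryGroup (Fin k' × Fin n') ℂ := fun t =>
    mul_mem (hu t) (relabel_mem_unitaryGroup e P₀)
  have h' : ∀ (f : razakBlock n k) t, (φ f : MatPath (Fin k' × Fin n')) t =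
      (u t * relabel e P₀) *
        blockDiagonalHom P₀ (fun i => (f : MatPath (Fin k × Fin n)) (ξ i t)) *
        star (u t * relabel e P₀) := fun f t => by
    rw [h, ← relabel_mul_mul_star e P₀, star_mul]
    simp only [mul_assoc]
    rfl
  have : Nonempty (Fin n') := ⟨⟨0, hn'⟩⟩
  obtain ⟨β, hβ, hint⟩ := exists_unitary_of_blockDiagonal (hu' 0)
  have hends : ∀ f : razakBlock n k,
      (φ f : MatPath (Fin k' × Fin n')) 0 = cutDiag n' n' k' β 1 *
        blockDiagonalHom P₀ (fun i => (f : MatPath (Fin k × Fin n)) (ξ i 0)) *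
          star (cutDiag n' n' k' β 1) ∧
      (φ f : MatPath (Fin k' × Fin n')) 1 = cutDiag (n' - 1) n' k' β 1 * relabel P₁ P₀ *
        blockDiagonalHom P₀ (fun i => (f : MatPath (Fin k × Fin n)) (ξ i 1)) *
          star (cutDiag (n' - 1) n' k' β 1 * relabel P₁ P₀) := fun f => by
    obtain ⟨E, hE0, hE1⟩ := hP f
    obtain ⟨b, hb0, hb1⟩ := mem_razakBlock.mp (φ f).2
    have hE : β * E * star β = b := hint E b (by
      rw [← cutDiag_self n' k' E 0, ← cutDiag_self n' k' b 0, ← hb0, ← hE0, ← h'])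
    constructor
    · rw [hb0, hE0, star_cutDiag, cutDiag_mul, cutDiag_mul, hE, mul_zero, zero_mul]
    · have h1 : relabel P₁ P₀ *
          blockDiagonalHom P₀ (fun i => (f : MatPath (Fin k × Fin n)) (ξ i 1)) *
          star (relabel P₁ P₀) = cutDiag (n' - 1) n' k' E 0 :=
        (relabel_mul_mul_star P₁ P₀ _).trans hE1
      calc (φ f : MatPath (Fin k' × Fin n')) 1
          = cutDiag (n' - 1) n' k' β 1 * cutDiag (n' - 1) n' k' E 0 *
              star (cutDiag (n' - 1) n' k' β 1) := by
            rw [hb1, star_cutDiag, cutDiag_mul, cutDiag_mul, hE, mul_zero, zero_mul]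
        _ = _ := by
            rw [← h1, star_mul]
            simp only [mul_assoc]
  let w : I → unitary (Matrix (Fin k' × Fin n') (Fin k' × Fin n') ℂ) := fun t =>
    if t = 0 then ⟨_, cutDiag_mem_unitaryGroup n' n' hβ⟩
    else if t = 1 then ⟨_, mul_mem (cutDiag_mem_unitaryGroup (n' - 1) n' hβ)
      (relabel_mem_unitaryGroup P₁ P₀)⟩
    else ⟨_, hu' t⟩
  obtain ⟨v, hv0, hv1, hv⟩ := exists_continuous_conjError_lt (J := F)
    (Φ := fun f t => (φ f : MatPath (Fin k' × Fin n')) t)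
    (D := fun f t => blockDiagonalHom P₀ (fun i => ((f : razakBlock n k) :
      MatPath (Fin k × Fin n)) (ξ i t)))
    (fun f => (φ f : MatPath (Fin k' × Fin n')).continuous)
    (fun f => (continuous_blockDiagonalHom P₀).comp
      (continuous_pi fun i => (f : MatPath (Fin k × Fin n)).continuous.comp (ξ i).continuous))
    (fun f t => congrArg (fun g : razakBlock n' k' => (g : MatPath (Fin k' × Fin n')) t)
      ((hF f f.2).map φ))
    (u := w) (fun t f => by
      unfold conjError
      rw [norm_eq_zero, sub_eq_zero]
      by_cases ht0 : t = 0
      · subst ht0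
        simpa [w] using (hends f).1
      by_cases ht1 : t = 1
      · subst ht1
        simpa [w] using (hends f).2
      · simpa [w, ht0, ht1] using h' f t) hε
  refine ⟨β, hβ, v, ?_, ?_, fun t f hf => hv t ⟨f, hf⟩⟩
  · rw [hv0]; simp [w]
  · rw [hv1]; simp [w]

/-- Conjugation by `w(y) w(x)⋆` takes `f(x)` to within `|x - y|` of `f(y)`, for all `f` in the Lipschitz
family at once. -/
theorem IsLipschitzFamily.exists_conj_lipschitz {A : NonUnitalStarSubalgebra ℂ (MatPath ι)}
    {L : Set A} (hL : IsLipschitzFamily L) :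
    ∃ w : MatPath ι, (∀ t, w t ∈ unitaryGroup ι ℂ) ∧ ∀ f ∈ L, IsSelfAdjoint f ∧
      ∀ x y, ‖w y * star (w x) * (f : MatPath ι) x * star (w y * star (w x)) -
        (f : MatPath ι) y‖ ≤ dist x y := by
  obtain ⟨w, hw, -, -, hLw⟩ := hL
  refine ⟨w, hw, fun f hf => ?_⟩
  obtain ⟨g, ⟨-, hg, -, hlip⟩, hgf⟩ : (f : MatPath ι) ∈
      (fun g => w * g * star w) '' lipUnit ((fun f => star w * f * w) '' (A : Set (MatPath ι))) :=
    hLw ▸ ⟨f, hf, rfl⟩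
  refine ⟨?_, fun x y => ?_⟩
  · apply Subtype.ext
    change star (f : MatPath ι) = f
    rw [← hgf]
    exact hg.conjugate w
  · have h1 : star (w x) * w x = 1 := (Unitary.mem_iff.mp (hw x)).1
    have h2 : ∀ t, (f : MatPath ι) t = w t * g t * star (w t) := fun t => by rw [← hgf]; rfl
    have h3 : w y * star (w x) * (f : MatPath ι) x * star (w y * star (w x)) - (f : MatPath ι) y =
        w y * (g x - g y) * star (w y) := by
      rw [h2, h2, star_mul, star_star]
      calc _ = w y * (star (w x) * w x) * g x * (star (w x) * w x) * star (w y) -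
              w y * g y * star (w y) := by noncomm_ring
        _ = _ := by rw [h1]; noncomm_ring
    rw [h3, CStarRing.norm_mul_mem_unitary _ (Unitary.star_mem (hw y)),
      CStarRing.norm_mem_unitary_mul _ (hw y)]
    exact hlip x y

end UnitaryEquivalence

/-! ### The unitary distance is at most the diagonal distance -/

section DiagonalDistance

open Matrix

/-- The unitary is `z = v' W v⋆`: here `v` and `v'` approximately implement `φ` and `ψ`, and
`W(t)` is block diagonal with blocks `w(η_i(t)) w(ξ_i(t))⋆`, where `w` is the path of unitaries that
defines the Lipschitz family. -/
theorem exists_unitary_norm_conj_sub_lt {n k n' k' l : ℕ} (hn : 0 < n) (hk : 0 < k) (hn' : 0 < n')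
    {φ ψ : razakBlock n k →⋆ₙₐ[ℂ] razakBlock n' k'} {ξ η : Fin l → C(I, I)}
    (hφ : IsDiagonalWith φ ξ) (hψ : IsDiagonalWith ψ η) {L : Set (razakBlock n k)}
    (hL : IsLipschitzFamily L) {d : ℝ} (hd0 : 0 ≤ d) (hd : ∀ i t, dist (ξ i t) (η i t) ≤ d)
    (F : Finset (razakBlock n k)) (hF : (F : Set (razakBlock n k)) ⊆ L) {ε : ℝ} (hε : 0 < ε) :
    ∃ z : MatPath (Fin k' × Fin n'), z ∈ unitary (MatPath (Fin k' × Fin n')) ∧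
      z - 1 ∈ razakBlock n' k' ∧
      ∀ f ∈ F, ‖z * (φ f : MatPath (Fin k' × Fin n')) * star z - (ψ f : MatPath _)‖ ≤
        d + 2 * ε := by
  obtain ⟨w, hw, hLw⟩ := hL.exists_conj_lipschitz
  have hsize : n * k * l = n' * k' := by
    have := hφ.card_eq
    simp only [Fintype.card_prod, Fintype.card_fin] at this
    rw [mul_comm n, mul_comm n', this]
  obtain ⟨Tξ, cξ₀, cξ₁⟩ := hφ.exists_isCount hn hk hn'
  obtain ⟨Tη, cη₀, cη₁⟩ := hψ.exists_isCount hn hk hn'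
  obtain ⟨P₀, P₁, hP⟩ := exists_endpoint_equiv hn hn' hsize (hφ.1 0) (hφ.1 1) (hψ.1 0) (hψ.1 1)
    cξ₀ cξ₁ cη₀ cη₁
  have hFsa : ∀ f ∈ F, IsSelfAdjoint f := fun f hf => (hLw f (hF hf)).1
  obtain ⟨β, hβ, v, hv0, hv1, hv⟩ := hφ.exists_continuous_unitary hn' (P₀ := P₀) (P₁ := P₁)
    (fun f => by
      obtain ⟨a, h0, h1⟩ := mem_razakBlock.mp f.2
      exact hP a 0 (fun x _ => (f : MatPath (Fin k × Fin n)) x) h0 h1) F hFsa hε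
  obtain ⟨β', hβ', v', hv0', hv1', hv'⟩ := hψ.exists_continuous_unitary hn' (P₀ := P₀) (P₁ := P₁)
    (fun f => by
      obtain ⟨a, h0, h1⟩ := mem_razakBlock.mp f.2
      exact hP a 0 (fun _ y => (f : MatPath (Fin k × Fin n)) y) h0 h1) F hFsa hε
  let ω : I → Fin l → Matrix (Fin k × Fin n) (Fin k × Fin n) ℂ :=
    fun t i => w (η i t) * star (w (ξ i t))
  have hω : ∀ t, ω t ∈ unitary (Fin l → Matrix (Fin k × Fin n) (Fin k × Fin n) ℂ) := fun t => by
    rw [Unitary.mem_iff]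
    have : ∀ i, ω t i ∈ unitaryGroup (Fin k × Fin n) ℂ :=
      fun i => mul_mem (hw _) (Unitary.star_mem (hw _))
    exact ⟨funext fun i => (Unitary.mem_iff.mp (this i)).1,
      funext fun i => (Unitary.mem_iff.mp (this i)).2⟩
  obtain ⟨c, hc0, hc1⟩ := hP 1 1 (fun x y => w y * star (w x))
    (by rw [cutDiag_one_one]; exact (Unitary.mem_iff.mp (hw 0)).2)
    (by rw [cutDiag_one_one]; exact (Unitary.mem_iff.mp (hw 1)).2)
  have hc0' : blockDiagonalHom P₀ (ω 0) = cutDiag n' n' k' c 1 := hc0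
  have hc1' : relabel P₁ P₀ * blockDiagonalHom P₀ (ω 1) * star (relabel P₁ P₀) =
      cutDiag (n' - 1) n' k' c 1 := (relabel_mul_mul_star P₁ P₀ _).trans hc1
  let z : MatPath (Fin k' × Fin n') :=
    { toFun := fun t => (v' t : Matrix _ _ ℂ) * blockDiagonalHom P₀ (ω t) *
        star (v t : Matrix (Fin k' × Fin n') (Fin k' × Fin n') ℂ)
      continuous_toFun := by
        have h1 : Continuous fun t => blockDiagonalHom P₀ (ω t) :=
          (continuous_blockDiagonalHom P₀).comp (continuous_pi fun i =>
            (w.continuous.comp (η i).continuous).mul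
              (continuous_star.comp (w.continuous.comp (ξ i).continuous)))
        have h2 : Continuous fun t => (v t : Matrix (Fin k' × Fin n') (Fin k' × Fin n') ℂ) :=
          continuous_subtype_val.comp v.continuous
        have h3 : Continuous fun t => (v' t : Matrix (Fin k' × Fin n') (Fin k' × Fin n') ℂ) :=
          continuous_subtype_val.comp v'.continuous
        exact (h3.mul h1).mul (continuous_star.comp h2) }
  have hz : ∀ t, z t = (v' t : Matrix _ _ ℂ) * blockDiagonalHom P₀ (ω t) *
        star (v t : Matrix (Fin k' × Fin n') (Fin k' × Fin n') ℂ) := fun t => rfl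
  have hzu : ∀ t, z t ∈ unitary (Matrix (Fin k' × Fin n') (Fin k' × Fin n') ℂ) := fun t =>
    mul_mem (mul_mem (v' t).2 (Unitary.map_mem _ (hω t))) (Unitary.star_mem (v t).2)
  refine ⟨z, ?_, ?_, fun f hf => ?_⟩
  · rw [Unitary.mem_iff]
    exact ⟨ContinuousMap.ext fun t => (Unitary.mem_iff.mp (hzu t)).1,
      ContinuousMap.ext fun t => (Unitary.mem_iff.mp (hzu t)).2⟩
  · refine mem_razakBlock.mpr ⟨β' * c * star β - 1, ?_, ?_⟩
    · rw [ContinuousMap.sub_apply, ContinuousMap.one_apply, hz, hv0, hv0', hc0', star_cutDiag,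
        cutDiag_mul, cutDiag_mul, ← cutDiag_one_one n' n' k', cutDiag_sub]
      simp
    · have h1 : z 1 = cutDiag (n' - 1) n' k' (β' * c * star β) 1 := by
        rw [hz, hv1, hv1']
        calc _ = cutDiag (n' - 1) n' k' β' 1 *
              (relabel P₁ P₀ * blockDiagonalHom P₀ (ω 1) * star (relabel P₁ P₀)) *
              star (cutDiag (n' - 1) n' k' β 1) := by
              rw [star_mul]; simp only [mul_assoc]
          _ = _ := by
              rw [hc1', star_cutDiag, cutDiag_mul, cutDiag_mul]; simp
      rw [ContinuousMap.sub_apply, ContinuousMap.one_apply, h1, ← cutDiag_one_one (n' - 1) n' k',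
        cutDiag_sub, sub_self]
  · refine (ContinuousMap.norm_le _ (by positivity)).mpr fun t => ?_
    have hfφ := hv t f hf
    have hfψ := hv' t f hf
    set Φ := (φ f : MatPath (Fin k' × Fin n')) t
    set Ψ := (ψ f : MatPath (Fin k' × Fin n')) t
    set V : Matrix (Fin k' × Fin n') (Fin k' × Fin n') ℂ := (v t).1
    set V' : Matrix (Fin k' × Fin n') (Fin k' × Fin n') ℂ := (v' t).1
    set Dξ := blockDiagonalHom P₀ (fun i => (f : MatPath (Fin k × Fin n)) (ξ i t))
    set Dη := blockDiagonalHom P₀ (fun i => (f : MatPath (Fin k × Fin n)) (η i t))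
    set Ω := blockDiagonalHom P₀ (ω t)
    have hV : star V * V = 1 := (Unitary.mem_iff.mp (v t).2).1
    have hmid : ‖Ω * Dξ * star Ω - Dη‖ ≤ d := by
      have : Ω * Dξ * star Ω - Dη = blockDiagonalHom P₀ fun i =>
          ω t i * (f : MatPath (Fin k × Fin n)) (ξ i t) * star (ω t i) -
            (f : MatPath (Fin k × Fin n)) (η i t) := by
        simp only [Ω, Dξ, Dη, ← map_star, ← map_mul, ← map_sub]
        rfl
      rw [this]
      exact norm_blockDiagonalHom_le P₀ hd0 fun i =>
        ((hLw f (hF hf)).2 (ξ i t) (η i t)).trans (hd i t)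
    have hsplit : z t * Φ * star (z t) - Ψ = z t * (Φ - V * Dξ * star V) * star (z t) +
        V' * (Ω * Dξ * star Ω - Dη) * star V' - (Ψ - V' * Dη * star V') := by
      have h1 : z t * (V * Dξ * star V) * star (z t) = V' * (Ω * Dξ * star Ω) * star V' := by
        rw [hz]
        calc _ = V' * Ω * (star V * V) * Dξ * (star V * V) * star Ω * star V' := by
              rw [star_mul, star_mul, star_star]; simp only [mul_assoc]; rfl
          _ = _ := by rw [hV]; simp only [mul_one, mul_assoc]
      rw [mul_sub, sub_mul, h1]
      noncomm_ring
    change ‖z t * Φ * star (z t) - Ψ‖ ≤ d + 2 * ε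
    rw [hsplit]
    refine (norm_sub_le _ _).trans ?_
    refine (add_le_add_left (norm_add_le _ _) _).trans ?_
    rw [CStarRing.norm_mul_mem_unitary _ (Unitary.star_mem (hzu t)),
      CStarRing.norm_mem_unitary_mul _ (hzu t),
      CStarRing.norm_mul_mem_unitary _ (Unitary.star_mem (v' t).2),
      CStarRing.norm_mem_unitary_mul _ (v' t).2]
    linarith

theorem unitaryDist_le_diagonalDist {n k n' k' l : ℕ} (hn : 0 < n) (hk : 0 < k) (hn' : 0 < n')
    {φ ψ : razakBlock n k →⋆ₙₐ[ℂ] razakBlock n' k'} {ξ η : Fin l → C(I, I)}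
    (hφ : IsDiagonalWith φ ξ) (hψ : IsDiagonalWith ψ η) {L : Set (razakBlock n k)}
    (hL : IsLipschitzFamily L) :
    unitaryDist (B := razakBlock n' k') L φ ψ ≤ diagonalDist ξ η := by
  have hfin : diagonalDist ξ η ≠ ⊤ := by
    refine ne_top_of_le_ne_top ENNReal.one_ne_top (iSup₂_le fun t i => ?_)
    rw [edist_dist, ← ENNReal.ofReal_one]
    refine ENNReal.ofReal_le_ofReal ?_
    rw [Subtype.dist_eq, Real.dist_eq]
    exact abs_le.mpr ⟨by linarith [(ξ i t).2.1, (η i t).2.2], by linarith [(ξ i t).2.2, (η i t).2.1]⟩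
  have hd : ∀ i t, dist (ξ i t) (η i t) ≤ (diagonalDist ξ η).toReal := fun i t => by
    rw [dist_edist]
    exact ENNReal.toReal_mono hfin (le_iSup₂_of_le t i le_rfl)
  refine iSup₂_le fun F hF => ENNReal.le_of_forall_pos_le_add fun ε hε _ => ?_
  have hε' : (0 : ℝ) < ε / 2 := by positivity
  obtain ⟨z, hz, hzB, hzF⟩ := exists_unitary_norm_conj_sub_lt hn hk hn' hφ hψ hL
    ENNReal.toReal_nonneg hd F hF hε'
  obtain ⟨u, hu⟩ := exists_unitary_unitization (B := razakBlock n' k')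
    (NonUnitalStarSubalgebraClass.subtype (razakBlock n' k')) Subtype.val_injective
    (y := ⟨z - 1, hzB⟩) (by
      change 1 + (z - 1) ∈ _
      rwa [add_sub_cancel])
  refine iInf_le_of_le u (iSup₂_le fun f hf => ?_)
  have h1 : (diagonalDist ξ η) + ε = ENNReal.ofReal ((diagonalDist ξ η).toReal + 2 * (ε / 2)) := by
    rw [mul_div_cancel₀ _ two_ne_zero, ENNReal.ofReal_add ENNReal.toReal_nonneg ε.coe_nonneg,
      ENNReal.ofReal_toReal hfin, ENNReal.ofReal_coe_nnreal]
  rw [h1, ← ofReal_norm]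
  refine ENNReal.ofReal_le_ofReal ((hu _ _).trans_le ?_)
  refine le_trans (le_of_eq ?_) (hzF f hf)
  change ‖(1 + (z - 1)) * (φ f : MatPath (Fin k' × Fin n')) * star (1 + (z - 1)) -
    (ψ f : MatPath (Fin k' × Fin n'))‖ = _
  rw [add_sub_cancel]

end DiagonalDistance

end

theorem proposition4p14 (n k n' k' : ℕ) (hn : 0 < n) (hk : 0 < k) (hn' : 0 < n') (hk' : 0 < k')
    (φ ψ : razakBlock n k →⋆ₙₐ[ℂ] razakBlock n' k')
    (hφ : Function.Injective φ) (hψ : Function.Injective ψ)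
    (l : ℕ) (ξ η : Fin l → C(unitInterval, unitInterval))
    (hξ : IsDiagonalWith φ ξ) (hη : IsDiagonalWith ψ η)
    (L : Set (razakBlock n k)) (hL : IsLipschitzFamily L) :
    unitaryDist (B := razakBlock n' k') L φ ψ = diagonalDist ξ η ∧
      diagonalDist ξ η = cuntzDist (B := razakBlock n' k') L φ ψ := by
  have h1 := unitaryDist_le_diagonalDist hn hk hn' hξ hη hL
  have h2 := diagonalDist_le_cuntzDist hn hk hξ hη hL
  obtain ⟨w, -, hw⟩ := hL.exists_conj_lipschitz
  have h3 := cuntzDist_le_unitaryDist (B := razakBlock n' k') (fun f hf => (hw f hf).1) φ ψ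
  exact ⟨le_antisymm h1 (h2.trans h3), le_antisymm h2 (h3.trans h1)⟩
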